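/- Let $d\ge 1$ be an integer and $s\in(0,d/2)$. Let $H^s(\mathbb{R}^d)$ be the Sobolev space of (complex-valued) functions $f\in L^2(\mathbb{R}^d)$ with $\|f\|_{H^s}:=\|(1-\Delta)^{s/2}f\|_{L^2}<\infty$, and let $(u_n)_{n}$ be a bounded sequence in $H^s(\mathbb{R}^d)$. Then there exist a subsequence of $(u_n)$ (still denoted by $(u_n)$), functions $(v^j)_{j\ge1}\subset H^s(\mathbb{R}^d)$ and points $(x_n^j)_{j\ge1,\,n}\subset\mathbb{R}^d$ such that, defining for all $J\ge1$ and all $n$ $$r_n^J:=u_n-\sum_{j=1}^J v^j(\cdot+x_n^j),$$ the following hold. 1. For all $J\ge1$: $\displaystyle \|u_n\|_{H^s}^2=\sum_{j=1}^J\|v^j\|_{H^s}^2+\|r_n^J\|_{H^s}^2+o(1)$ as $n\to\infty$. 2. For all $q\in\left(2,\tfrac{2d}{d-2s}\right)$ and all $J\ge1$, the $u_n$ and the $v^j$ belong to $L^q(\mathbb{R}^d)$ and $\displaystyle \|u_n\|_{L^q}^q=\sum_{j=1}^J\|v^j\|_{L^q}^q+\|r_n^J\|_{L^q}^q+o(1)$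 as $n\to\infty$. 3. For all $j\ne j'$: $\displaystyle \lim_{n\to\infty}|x_n^j-x_n^{j'}|=+\infty$. 4. For all $q\in\left(2,\tfrac{2d}{d-2s}\right)$: $\displaystyle \lim_{J\to\infty}\limsup_{n\to\infty}\|r_n^J\|_{L^q}=0$. -/

import Mathlib

open MeasureTheory Filter Topology FourierTransform
open scoped ENNReal SchwartzMap

noncomputable section

/-- The Hilbert space `L²(ℝᵈ)` of complex-valued square-integrable functions. -/
abbrev LTwo (d : ℕ) : Type :=
  Lp ℂ 2 (volume : Measure (EuclideanSpace ℝ (Fin d)))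

/-- The inhomogeneous Sobolev space `Hˢ(ℝᵈ)`, `s ≥ 0`, as a set of elements of `L²(ℝᵈ)`. -/
def MemHs {d : ℕ} (s : ℝ) (f : LTwo d) : Prop :=
  TemperedDistribution.MemSobolev s 2 (f : 𝓢'(EuclideanSpace ℝ (Fin d), ℂ))

/-- The Fourier transform of `(1 - Δ)^{s/2} f`. With the convention
`𝓕 f ξ = ∫ exp (-2πi⟨x, ξ⟩) f x dx`, the symbol of `-Δ` is `(2π‖ξ‖)²`. -/
def besselFourier {d : ℕ} (s : ℝ) (f : LTwo d) : EuclideanSpace ℝ (Fin d) → ℂ :=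
  fun ξ => (((1 + (2 * Real.pi * ‖ξ‖) ^ 2) ^ (s / 2) : ℝ) : ℂ) * (𝓕 f : LTwo d) ξ

/-- The norm `‖f‖_{Hˢ} = ‖(1 - Δ)^{s/2} f‖_{L²}`, computed on the Fourier side. It is finite, so
that no information is lost by `toReal`, exactly on `Hˢ(ℝᵈ)`: see `memHs_iff`. -/
def hsNorm {d : ℕ} (s : ℝ) (f : LTwo d) : ℝ :=
  (eLpNorm (besselFourier s f) 2 volume).toReal

/-- The norm `‖f‖_{L^q}` (meaningful if `f ∈ L^q`). -/
def lqNorm {d : ℕ} (q : ℝ) (f : LTwo d) : ℝ :=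
  (eLpNorm f (ENNReal.ofReal q) volume).toReal

/-- The translated function `f(· + a)`. -/
def translateLTwo {d : ℕ} (a : EuclideanSpace ℝ (Fin d)) (f : LTwo d) : LTwo d :=
  Lp.compMeasurePreserving (fun y => y + a) (measurePreserving_add_right volume a) f

/-- The remainder `r_n^J = u_n - ∑_{j ≤ J} v^j(· + x_n^j)`; the profiles are numbered from `0`,
so the first `J` of them are those with `j < J`. -/
def profileRemainder {d : ℕ} (u : ℕ → LTwo d) (v : ℕ → LTwo d)
    (x : ℕ → ℕ → EuclideanSpace ℝ (Fin d)) (J n : ℕ) : LTwo d :=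
  u n - ∑ j ∈ Finset.range J, translateLTwo (x j n) (v j)

theorem coeFn_translateLTwo {d : ℕ} (a : EuclideanSpace ℝ (Fin d)) (f : LTwo d) :
    translateLTwo a f =ᵐ[volume] fun y => f (y + a) :=
  Lp.coeFn_compMeasurePreserving f (measurePreserving_add_right volume a)

theorem memHs_iff_memLp_mul {d : ℕ} (s : ℝ) (f : LTwo d) :
    MemHs s f ↔ MemLp (fun ξ => (((1 + ‖ξ‖ ^ 2) ^ (s / 2) : ℝ) : ℂ) * (𝓕 f : LTwo d) ξ)
      2 volume := by
  have hmul : ∀ g : LTwo d, (∃ h : LTwo d,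
      TemperedDistribution.smulLeftCLM ℂ
        (fun ξ : EuclideanSpace ℝ (Fin d) => (((1 + ‖ξ‖ ^ 2) ^ (s / 2) : ℝ) : ℂ))
        (g : 𝓢'(EuclideanSpace ℝ (Fin d), ℂ)) = h) ↔
      MemLp (fun ξ => (((1 + ‖ξ‖ ^ 2) ^ (s / 2) : ℝ) : ℂ) * g ξ) 2 volume := by
    intro g
    have key : ∀ (φ : 𝓢(EuclideanSpace ℝ (Fin d), ℂ)),
        TemperedDistribution.smulLeftCLM ℂ
          (fun ξ : EuclideanSpace ℝ (Fin d) => (((1 + ‖ξ‖ ^ 2) ^ (s / 2) : ℝ) : ℂ))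
          (g : 𝓢'(EuclideanSpace ℝ (Fin d), ℂ)) φ =
        ∫ ξ, φ ξ * ((((1 + ‖ξ‖ ^ 2) ^ (s / 2) : ℝ) : ℂ) * g ξ) := by
      intro φ
      rw [TemperedDistribution.smulLeftCLM_apply_apply, Lp.toTemperedDistribution_apply]
      congr 1
      ext ξ
      rw [SchwartzMap.smulLeftCLM_apply_apply (by fun_prop)]
      simp only [smul_eq_mul]
      ring
    constructor
    · rintro ⟨h, hh⟩
      have hloc : LocallyIntegrable
          (fun ξ => (((1 + ‖ξ‖ ^ 2) ^ (s / 2) : ℝ) : ℂ) * g ξ) volume := by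
        have h1 := ((Lp.memLp g).locallyIntegrable (by norm_num)).locallyIntegrableOn Set.univ
        rw [← locallyIntegrableOn_univ]
        refine h1.continuousOn_mul (g := fun ξ => (((1 + ‖ξ‖ ^ 2) ^ (s / 2) : ℝ) : ℂ)) ?_
          isOpen_univ.isLocallyClosed
        have ht : (fun ξ : EuclideanSpace ℝ (Fin d) =>
          (((1 + ‖ξ‖ ^ 2) ^ (s / 2) : ℝ) : ℂ)).HasTemperateGrowth := by fun_prop
        exact ht.1.continuous.continuousOn
      have hae := ae_eq_of_integral_contDiff_smul_eq hloc
        ((Lp.memLp h).locallyIntegrable (by norm_num)) (by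
          intro φ φ_smooth φ_cpt
          have hg₁ : HasCompactSupport (Complex.ofRealCLM ∘ φ) := φ_cpt.comp_left rfl
          have hg₂ : ContDiff ℝ ((⊤ : ℕ∞) : WithTop ℕ∞) (Complex.ofRealCLM ∘ φ) := by fun_prop
          have h2 := key (hg₁.toSchwartzMap hg₂)
          rw [hh, Lp.toTemperedDistribution_apply] at h2
          simpa using h2.symm)
      exact (memLp_congr_ae hae).mpr (Lp.memLp h)
    · intro h
      refine ⟨h.toLp _, ?_⟩
      ext φ
      rw [key, Lp.toTemperedDistribution_apply]
      apply integral_congr_ae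
      filter_upwards [h.coeFn_toLp] with ξ hξ
      rw [hξ, smul_eq_mul]
  rw [← hmul, MemHs, TemperedDistribution.memSobolev_iff_exists_smulLeftCLM_fourier,
    Lp.fourier_toTemperedDistribution_eq]

theorem memHs_iff {d : ℕ} {s : ℝ} (hs : 0 ≤ s) (f : LTwo d) :
    MemHs s f ↔ MemLp (besselFourier s f) 2 volume := by
  have hm : AEStronglyMeasurable ((𝓕 f : LTwo d) : EuclideanSpace ℝ (Fin d) → ℂ) volume :=
    (Lp.memLp (𝓕 f : LTwo d)).1
  have hpi : (1 : ℝ) ≤ (2 * Real.pi) ^ 2 := by nlinarith [Real.pi_gt_three]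
  rw [memHs_iff_memLp_mul]
  constructor
  · intro h
    refine h.of_le_mul (c := ((2 * Real.pi) ^ 2) ^ (s / 2)) ?_ (Eventually.of_forall fun ξ => ?_)
    · exact (Continuous.aestronglyMeasurable (by
        refine Complex.continuous_ofReal.comp (Continuous.rpow_const (by fun_prop) ?_)
        intro ξ; right; positivity)).mul hm
    · rw [besselFourier, norm_mul, norm_mul, ← mul_assoc, Complex.norm_real, Complex.norm_real,
        Real.norm_of_nonneg (by positivity), Real.norm_of_nonneg (by positivity),
        ← Real.mul_rpow (by positivity) (by positivity)]
      gcongr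
      rw [mul_pow _ ‖ξ‖]
      linarith
  · intro h
    refine h.of_le_mul (c := 1) ?_ (Eventually.of_forall fun ξ => ?_)
    · exact (Continuous.aestronglyMeasurable (by
        refine Complex.continuous_ofReal.comp (Continuous.rpow_const (by fun_prop) ?_)
        intro ξ; right; positivity)).mul hm
    · rw [besselFourier, norm_mul, norm_mul, one_mul, Complex.norm_real, Complex.norm_real,
        Real.norm_of_nonneg (by positivity), Real.norm_of_nonneg (by positivity)]
      gcongr
      nlinarith [norm_nonneg ξ, Real.pi_gt_three]

end

/-! The Bessel potential `(1 - Δ)^{-s/2}` carries L² isometrically onto Hˢ and commutes with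
translations. So one writes u_n as the potential of g_n, bounded in L², and decomposes g_n in L²
with respect to translations.

Profiles are extracted greedily: from the current remainder one subtracts a translate of a weak
limit of recentred remainders whose norm is at least half the supremum of such norms. Limits are
taken along one ultrafilter, where every bounded sequence converges weakly, so nothing is extracted
during the construction; a single subsequence is taken at the end (`exists_profiles_subsequence`).
Recentring and expanding the square gives the L² decoupling, hence ∑‖ψ_j‖² is finite and ψ_J → 0.
Cores diverge because the recentred remainder has weak limit zero at old cores and a nonzero one at
a new core (`tendsto_norm_sub_of_profiles`).

The passage to L^q splits frequencies. The block |ξ| ~ 2^N of the potential is O(2^{-Ns}) in L² and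
O(2^{N(d/2-s)}) in L^∞, so interpolation gives a geometric series in L^q, convergent exactly when q
< 2d/(d-2s): high frequencies are uniformly small. The low-frequency part at x is the inner product
of a fixed L² kernel with the translate by x. Weak convergence therefore gives bounded pointwise
convergence, from which the Brezis–Lieb decoupling in L^q follows; and a bound on all remaining
profiles, of order ‖ψ_J‖, becomes a sup bound on the low part of the remainder, which interpolates
with L² to give smallness in L^q. -/

noncomputable section

/-! ### Translations on L² and their Fourier side -/

section FourierAnalysis

open scoped RealInnerProductSpace

variable {d : ℕ}

theorem translateLTwo_sub (a : EuclideanSpace ℝ (Fin d)) (f g : LTwo d) :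
    translateLTwo a (f - g) = translateLTwo a f - translateLTwo a g :=
  map_sub (Lp.compMeasurePreservingₗᵢ ℂ _ (measurePreserving_add_right volume a)) f g

theorem inner_translateLTwo_translateLTwo (a : EuclideanSpace ℝ (Fin d)) (f g : LTwo d) :
    inner ℂ (translateLTwo a f) (translateLTwo a g) = inner ℂ f g :=
  (Lp.compMeasurePreservingₗᵢ ℂ _ (measurePreserving_add_right volume a)).inner_map_map f g

theorem norm_translateLTwo (a : EuclideanSpace ℝ (Fin d)) (f : LTwo d) :
    ‖translateLTwo a f‖ = ‖f‖ :=
  (Lp.compMeasurePreservingₗᵢ ℂ _ (measurePreserving_add_right volume a)).norm_map f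

theorem translateLTwo_translateLTwo (a b : EuclideanSpace ℝ (Fin d)) (f : LTwo d) :
    translateLTwo a (translateLTwo b f) = translateLTwo (a + b) f := by
  apply Lp.ext
  have h := (measurePreserving_add_right volume a).quasiMeasurePreserving.ae_eq_comp
    (coeFn_translateLTwo b f)
  filter_upwards [coeFn_translateLTwo a (translateLTwo b f), h,
    coeFn_translateLTwo (a + b) f] with x h1 h2 h3
  rw [h1, h3]
  simpa [add_assoc] using h2

theorem translateLTwo_zero (f : LTwo d) : translateLTwo 0 f = f := by
  apply Lp.ext
  filter_upwards [coeFn_translateLTwo 0 f] with x h1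
  rw [h1, add_zero]

theorem translateLTwo_neg_translateLTwo (a : EuclideanSpace ℝ (Fin d)) (f : LTwo d) :
    translateLTwo (-a) (translateLTwo a f) = f := by
  rw [translateLTwo_translateLTwo, neg_add_cancel, translateLTwo_zero]

theorem inner_translateLTwo_left (a : EuclideanSpace ℝ (Fin d)) (f g : LTwo d) :
    inner ℂ (translateLTwo a f) g = inner ℂ f (translateLTwo (-a) g) := by
  rw [← inner_translateLTwo_translateLTwo (-a), translateLTwo_neg_translateLTwo]

/-- Strong continuity allows convergent translation parameters to be replaced by their limit when
testing weak convergence. -/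
theorem continuous_translateLTwo (f : LTwo d) :
    Continuous fun a : EuclideanSpace ℝ (Fin d) => translateLTwo a f := by
  rw [continuous_iff_continuousAt]
  intro a
  have hg : Continuous fun b : EuclideanSpace ℝ (Fin d) =>
      (⟨fun y => y + b, by fun_prop⟩ :
        C(EuclideanSpace ℝ (Fin d), EuclideanSpace ℝ (Fin d))) :=
    ContinuousMap.continuous_of_continuous_uncurry _ (by
      simp only [Function.uncurry_def]
      change Continuous fun p : EuclideanSpace ℝ (Fin d) × EuclideanSpace ℝ (Fin d) => p.2 + p.1
      fun_prop)
  exact Filter.Tendsto.compMeasurePreservingLp tendsto_const_nhds (hg.tendsto a)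
    (fun b => measurePreserving_add_right volume b) (measurePreserving_add_right volume a)
    (by simp)

theorem eLpNorm_translateLTwo (p : ℝ≥0∞) (a : EuclideanSpace ℝ (Fin d)) (f : LTwo d) :
    eLpNorm (translateLTwo a f) p volume = eLpNorm f p volume := by
  rw [eLpNorm_congr_ae (coeFn_translateLTwo a f)]
  exact eLpNorm_comp_measurePreserving (Lp.aestronglyMeasurable f)
    (measurePreserving_add_right volume a)

/-- On `L¹ ∩ L²`, the `L²` inverse Fourier transform is given by the Fourier integral. -/
theorem coeFn_fourierInv_of_integrable (f : LTwo d) (hf : Integrable f volume) :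
    (𝓕⁻ f : LTwo d) =ᵐ[volume] 𝓕⁻ (f : EuclideanSpace ℝ (Fin d) → ℂ) := by
  have hL : Continuous fun p : EuclideanSpace ℝ (Fin d) × EuclideanSpace ℝ (Fin d) =>
      (-innerₗ (EuclideanSpace ℝ (Fin d))) p.1 p.2 := by
    simp only [LinearMap.neg_apply, innerₗ_apply_apply]
    fun_prop
  have hc : Continuous (𝓕⁻ (f : EuclideanSpace ℝ (Fin d) → ℂ)) :=
    VectorFourier.fourierIntegral_continuous Real.continuous_fourierChar hL hf
  refine ae_eq_of_integral_contDiff_smul_eq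
    ((Lp.memLp (𝓕⁻ f : LTwo d)).locallyIntegrable (by norm_num)) hc.locallyIntegrable
    fun φ φ_smooth φ_cpt => ?_
  have hg₁ : HasCompactSupport (Complex.ofRealCLM ∘ φ) := φ_cpt.comp_left rfl
  have hg₂ : ContDiff ℝ ((⊤ : ℕ∞) : WithTop ℕ∞) (Complex.ofRealCLM ∘ φ) := by fun_prop
  have h := DFunLike.congr_fun (Lp.fourierInv_toTemperedDistribution_eq f)
    (hg₁.toSchwartzMap hg₂)
  rw [TemperedDistribution.fourierInv_apply, Lp.toTemperedDistribution_apply,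
    Lp.toTemperedDistribution_apply, SchwartzMap.fourierInv_coe] at h
  -- Fubini for the Fourier integral against a test function; the distributional definition of the
  -- L² transform in `h` yields the same pairing.
  have h2 := VectorFourier.integral_fourierIntegral_smul_eq_flip
    (μ := (volume : Measure (EuclideanSpace ℝ (Fin d))))
    (ν := (volume : Measure (EuclideanSpace ℝ (Fin d))))
    (L := -innerₗ (EuclideanSpace ℝ (Fin d)))
    (f := hg₁.toSchwartzMap hg₂) (g := f)
    Real.continuous_fourierChar hL (SchwartzMap.integrable _) hf
  have h3 : (-innerₗ (EuclideanSpace ℝ (Fin d))).flip = -innerₗ (EuclideanSpace ℝ (Fin d)) := by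
    ext x y
    simp [real_inner_comm]
  rw [h3] at h2
  have h4 := h.symm.trans h2
  simp only [HasCompactSupport.toSchwartzMap_toFun, Function.comp_apply, Complex.ofRealCLM_apply,
    smul_eq_mul] at h4
  simp only [Complex.real_smul]
  exact h4

/-- Translations become modulations under the Fourier transform. -/
theorem coeFn_fourier_translateLTwo (a : EuclideanSpace ℝ (Fin d)) (f : LTwo d) :
    (𝓕 (translateLTwo a f) : LTwo d) =ᵐ[volume]
      fun ξ => ((Real.fourierChar ⟪a, ξ⟫ : Circle) : ℂ) * (𝓕 f : LTwo d) ξ := by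
  have hm : MemLp (fun ξ : EuclideanSpace ℝ (Fin d) => ((Real.fourierChar ⟪a, ξ⟫ : Circle) : ℂ))
      ∞ volume := by
    refine memLp_top_of_bound (Continuous.aestronglyMeasurable ?_) 1
      (Eventually.of_forall fun x => (Circle.norm_coe _).le)
    exact continuous_induced_dom.comp (Real.continuous_fourierChar.comp (by fun_prop))
  have key : 𝓕 (translateLTwo a f) = (hm.toLp _ • (𝓕 f : LTwo d) : LTwo d) := by
    -- Both sides are continuous in `f`, so Schwartz functions suffice, where the transform is an
    -- honest integral.
    refine DenseRange.induction_on (p := fun f : LTwo d =>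
        𝓕 (translateLTwo a f) = (hm.toLp _ • (𝓕 f : LTwo d) : LTwo d))
      (SchwartzMap.denseRange_toLpCLM (p := 2) (μ := volume) ENNReal.ofNat_ne_top) f
      (isClosed_eq ?_ ?_) ?_
    · exact (Lp.fourierTransformₗᵢ _ _).continuous.comp
        (Lp.compMeasurePreservingₗᵢ ℂ _ (measurePreserving_add_right volume a)).continuous
    · have : LipschitzWith (‖hm.toLp _‖₊) fun g : LTwo d => (hm.toLp _ • g : LTwo d) := by
        refine LipschitzWith.of_dist_le_mul fun g h => ?_
        rw [dist_eq_norm_sub, dist_eq_norm_sub, sub_eq_add_neg, ← Lp.smul_neg,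
          ← Lp.add_smul, ← sub_eq_add_neg]
        exact Lp.norm_smul_le _ _
      exact this.continuous.comp (Lp.fourierTransformₗᵢ _ _).continuous
    · intro φ
      simp only [SchwartzMap.toLpCLM_apply]
      have h1 : translateLTwo a (φ.toLp 2) = (φ.compSubConstCLM ℂ (-a)).toLp 2 := by
        apply Lp.ext
        have h := (measurePreserving_add_right volume a).quasiMeasurePreserving.ae_eq_comp
          (φ.coeFn_toLp 2 volume)
        filter_upwards [coeFn_translateLTwo a (φ.toLp 2), h,
          (φ.compSubConstCLM ℂ (-a)).coeFn_toLp 2 volume] with x h1 h2 h3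
        rw [h1, h3]
        simpa using h2
      rw [h1, SchwartzMap.toLp_fourier_eq, SchwartzMap.toLp_fourier_eq]
      apply Lp.ext
      filter_upwards [(𝓕 (φ.compSubConstCLM ℂ (-a))).coeFn_toLp 2 volume,
        Lp.coeFn_lpSMul (r := 2) (hm.toLp _) ((𝓕 φ).toLp 2), hm.coeFn_toLp,
        (𝓕 φ).coeFn_toLp 2 volume] with x h1 h2 h3 h4
      rw [h1, h2, Pi.smul_apply', h3, h4, SchwartzMap.fourier_coe, SchwartzMap.fourier_coe]
      have := congrFun (VectorFourier.fourierIntegral_comp_add_right Real.fourierChar volume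
        (innerₗ (EuclideanSpace ℝ (Fin d))) φ a) x
      simp only [innerₗ_apply_apply] at this
      refine Eq.trans ?_ this
      refine congrFun (congrArg _ (funext fun y => ?_)) x
      simp
  rw [key]
  filter_upwards [Lp.coeFn_lpSMul (r := 2) (hm.toLp _) (𝓕 f : LTwo d), hm.coeFn_toLp] with ξ h1 h2
  rw [h1, Pi.smul_apply', h2, smul_eq_mul]

/-- Matrix coefficients of the translation group vanish at infinity. -/
theorem tendsto_inner_translateLTwo_cocompact (f g : LTwo d) :
    Tendsto (fun a : EuclideanSpace ℝ (Fin d) => inner ℂ g (translateLTwo a f))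
      (cocompact _) (𝓝 0) := by
  -- By Parseval the coefficient is the Fourier integral, at `-a`, of an L¹ product, so
  -- Riemann–Lebesgue applies; the sign is absorbed by the homeomorphism `a ↦ -a`.
  have h := tendsto_integral_exp_inner_smul_cocompact
    (fun ξ => (inner ℂ ((𝓕 g : LTwo d) ξ) ((𝓕 f : LTwo d) ξ) : ℂ))
  have h2 := h.comp (Homeomorph.neg (EuclideanSpace ℝ (Fin d))).isClosedEmbedding.tendsto_cocompact
  refine h2.congr fun a => ?_
  rw [← Lp.inner_fourier_eq, L2.inner_def]
  refine integral_congr_ae ?_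
  filter_upwards [coeFn_fourier_translateLTwo a f] with ξ hξ
  rw [hξ, ← smul_eq_mul, inner_smul_right, real_inner_comm]
  simp [Circle.smul_def]

end FourierAnalysis

/-! ### Fourier multipliers and their kernels -/

section FourierMultipliers

open scoped RealInnerProductSpace

variable {d : ℕ}

/-- The Fourier multiplier with bounded symbol `m`, acting on `L²(ℝᵈ)`. -/
def fourierMul {m : EuclideanSpace ℝ (Fin d) → ℂ} (hm : MemLp m ∞ volume) (f : LTwo d) : LTwo d :=
  𝓕⁻ (hm.toLp m • (𝓕 f : LTwo d) : LTwo d)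

variable {m : EuclideanSpace ℝ (Fin d) → ℂ} (hm : MemLp m ∞ volume)

theorem coeFn_fourier_fourierMul (f : LTwo d) :
    (𝓕 (fourierMul hm f) : LTwo d) =ᵐ[volume] fun ξ => m ξ * (𝓕 f : LTwo d) ξ := by
  rw [fourierMul, fourier_fourierInv_eq]
  filter_upwards [Lp.coeFn_lpSMul (r := 2) (hm.toLp m) (𝓕 f : LTwo d), hm.coeFn_toLp] with ξ h1 h2
  rw [h1, Pi.smul_apply', h2, smul_eq_mul]

theorem LTwo.ext_fourier {f g : LTwo d}
    (h : (𝓕 f : LTwo d) =ᵐ[volume] (𝓕 g : LTwo d)) : f = g :=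
  (Lp.fourierTransformₗᵢ _ _).injective (Lp.ext h)

theorem coeFn_fourier_sub (f g : LTwo d) :
    (𝓕 (f - g) : LTwo d) =ᵐ[volume] fun ξ => (𝓕 f : LTwo d) ξ - (𝓕 g : LTwo d) ξ := by
  have : (𝓕 (f - g) : LTwo d) = 𝓕 f - 𝓕 g := (Lp.fourierTransformₗᵢ _ _).map_sub f g
  rw [this]
  exact Lp.coeFn_sub _ _

theorem fourierMul_sub (f g : LTwo d) :
    fourierMul hm (f - g) = fourierMul hm f - fourierMul hm g := by
  apply LTwo.ext_fourier
  filter_upwards [coeFn_fourier_fourierMul hm f, coeFn_fourier_fourierMul hm g,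
    coeFn_fourier_fourierMul hm (f - g), coeFn_fourier_sub f g,
    coeFn_fourier_sub (fourierMul hm f) (fourierMul hm g)] with ξ h1 h2 h3 h4 h5
  rw [h3, h5, h1, h2, h4]
  ring

theorem fourierMul_translateLTwo (a : EuclideanSpace ℝ (Fin d)) (f : LTwo d) :
    fourierMul hm (translateLTwo a f) = translateLTwo a (fourierMul hm f) := by
  apply LTwo.ext_fourier
  filter_upwards [coeFn_fourier_fourierMul hm f, coeFn_fourier_fourierMul hm (translateLTwo a f),
    coeFn_fourier_translateLTwo a f, coeFn_fourier_translateLTwo a (fourierMul hm f)]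
    with ξ h1 h2 h3 h4
  rw [h2, h4, h1, h3]
  ring

theorem norm_fourierMul_le {C : ℝ} (hC : ∀ ξ, ‖m ξ‖ ≤ C) (f : LTwo d) :
    ‖fourierMul hm f‖ ≤ C * ‖f‖ := by
  rw [← Lp.norm_fourier_eq (fourierMul hm f), ← Lp.norm_fourier_eq f]
  refine Lp.norm_le_mul_norm_of_ae_le_mul ?_
  filter_upwards [coeFn_fourier_fourierMul hm f] with ξ h
  rw [h, norm_mul]
  gcongr
  exact hC ξ

theorem fourierMul_sub_fourierMul {m' : EuclideanSpace ℝ (Fin d) → ℂ} (hm' : MemLp m' ∞ volume)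
    (f : LTwo d) : fourierMul hm f - fourierMul hm' f = fourierMul (hm.sub hm') f := by
  apply LTwo.ext_fourier
  filter_upwards [coeFn_fourier_fourierMul hm f, coeFn_fourier_fourierMul hm' f,
    coeFn_fourier_fourierMul (hm.sub hm') f,
    coeFn_fourier_sub (fourierMul hm f) (fourierMul hm' f)] with ξ h1 h2 h3 h4
  rw [h3, h4, h1, h2, Pi.sub_apply]
  ring

/-- The convolution kernel of a Fourier multiplier with square-integrable symbol, arranged for use
in inner products. -/
def fourierMulKernel (hm2 : MemLp m 2 volume) : LTwo d :=
  𝓕⁻ (hm2.star.toLp (star m) : LTwo d)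

theorem norm_fourierMulKernel (hm2 : MemLp m 2 volume) :
    ‖fourierMulKernel hm2‖ = (eLpNorm m 2 volume).toReal := by
  rw [fourierMulKernel, ← Lp.norm_fourier_eq, fourier_fourierInv_eq, Lp.norm_toLp, eLpNorm_star]

/-- A square-integrable symbol times `𝓕 f` is integrable, so the inverse transform is a pointwise
integral, which Parseval rewrites as an inner product. This is the bridge from weak limits to
pointwise values. -/
theorem coeFn_fourierMul (hm2 : MemLp m 2 volume) (f : LTwo d) :
    fourierMul hm f =ᵐ[volume] fun x => inner ℂ (fourierMulKernel hm2) (translateLTwo x f) := by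
  have hae : (hm.toLp m • (𝓕 f : LTwo d) : LTwo d) =ᵐ[volume] fun ξ => m ξ * (𝓕 f : LTwo d) ξ := by
    filter_upwards [Lp.coeFn_lpSMul (r := 2) (hm.toLp m) (𝓕 f : LTwo d), hm.coeFn_toLp]
      with ξ h1 h2
    rw [h1, Pi.smul_apply', h2, smul_eq_mul]
  have hint : Integrable (hm.toLp m • (𝓕 f : LTwo d) : LTwo d) volume :=
    (hm2.integrable_mul (Lp.memLp (𝓕 f : LTwo d))).congr hae.symm
  refine (coeFn_fourierInv_of_integrable _ hint).trans (Eventually.of_forall fun x => ?_)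
  simp only
  rw [Real.fourierInv_congr_ae hae, Real.fourierInv_eq, fourierMulKernel,
    ← Lp.inner_fourier_eq, fourier_fourierInv_eq, L2.inner_def]
  refine integral_congr_ae ?_
  filter_upwards [coeFn_fourier_translateLTwo x f, hm2.star.coeFn_toLp] with ξ h1 h2
  rw [h1, h2, real_inner_comm, RCLike.inner_apply, Circle.smul_def, smul_eq_mul, Pi.star_apply,
    RCLike.star_def, RCLike.conj_conj]
  ring

end FourierMultipliers

/-! ### Interpolation between L² and L^∞ -/

section Interpolation

/-- Integrate the pointwise bound |f|^q ≤ |f|² C^{q-2} and take q-th roots. -/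
theorem eLpNorm_le_eLpNorm_two_rpow_mul_of_bound {α F : Type*} [MeasurableSpace α]
    [NormedAddCommGroup F] {μ : Measure α} {f : α → F} {C q : ℝ} (hq : 2 < q)
    (hC : ∀ᵐ x ∂μ, ‖f x‖ ≤ C) :
    eLpNorm f (ENNReal.ofReal q) μ ≤
      eLpNorm f 2 μ ^ (2 / q) * ENNReal.ofReal C ^ (1 - 2 / q) := by
  have hq0 : 0 < q := by linarith
  rw [eLpNorm_eq_lintegral_rpow_enorm_toReal (by simpa using hq0) (by simp),
    eLpNorm_eq_lintegral_rpow_enorm_toReal (by simp) (by simp), ENNReal.toReal_ofReal hq0.le,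
    ENNReal.toReal_ofNat, ← ENNReal.rpow_mul]
  have h1 : ∫⁻ x, ‖f x‖ₑ ^ q ∂μ ≤ (∫⁻ x, ‖f x‖ₑ ^ (2 : ℝ) ∂μ) * ENNReal.ofReal C ^ (q - 2) := by
    rw [← lintegral_mul_const' _ _ (ENNReal.rpow_ne_top_of_nonneg (by linarith) (by simp))]
    refine lintegral_mono_ae ?_
    filter_upwards [hC] with x hx
    have h2 : ‖f x‖ₑ ^ q = ‖f x‖ₑ ^ (2 : ℝ) * ‖f x‖ₑ ^ (q - 2) := by
      rw [← ENNReal.rpow_add_of_nonneg _ _ (by norm_num) (by linarith)]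
      congr 1
      ring
    rw [h2]
    gcongr
    rw [← ofReal_norm]
    exact ENNReal.ofReal_le_ofReal hx
  refine (ENNReal.rpow_le_rpow h1 (by positivity)).trans_eq ?_
  rw [ENNReal.mul_rpow_of_nonneg _ _ (by positivity), ← ENNReal.rpow_mul]
  congr 2
  · field_simp
  · field_simp

theorem LTwo.eLpNorm_le_of_bound {d : ℕ} {f : LTwo d} {A C q : ℝ} (hq : 2 < q) (hA : ‖f‖ ≤ A)
    (hC0 : 0 ≤ C) (hC : ∀ᵐ x, ‖f x‖ ≤ C) :
    eLpNorm f (ENNReal.ofReal q) volume ≤ ENNReal.ofReal (A ^ (2 / q) * C ^ (1 - 2 / q)) := by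
  have hq0 : 0 < q := by linarith
  have hq1 : 2 / q < 1 := (div_lt_one hq0).2 hq
  have hA0 : 0 ≤ A := (norm_nonneg _).trans hA
  refine (eLpNorm_le_eLpNorm_two_rpow_mul_of_bound hq hC).trans ?_
  rw [ENNReal.ofReal_mul (by positivity), ← ENNReal.ofReal_rpow_of_nonneg hC0 (by linarith),
    ← ENNReal.ofReal_rpow_of_nonneg hA0 (by positivity)]
  gcongr
  rw [← Lp.enorm_def, ← ofReal_norm]
  exact ENNReal.ofReal_le_ofReal hA

end Interpolation

/-! ### Bessel potentials, dyadic estimates, subcritical Sobolev embedding -/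

section BesselPotential

variable {d : ℕ} {s : ℝ}

/-- The symbol of `(1 - Δ)^{-s/2}`. -/
def besselSymbol (s : ℝ) (ξ : EuclideanSpace ℝ (Fin d)) : ℂ :=
  (((1 + (2 * Real.pi * ‖ξ‖) ^ 2) ^ (-(s / 2)) : ℝ) : ℂ)

/-- The symbol of `(1 - Δ)^{-s/2}` cut off to frequencies of size less than `2 ^ N`. -/
def lowBesselSymbol (s : ℝ) (N : ℕ) : EuclideanSpace ℝ (Fin d) → ℂ :=
  (Metric.ball 0 (2 ^ N)).indicator (besselSymbol s)

theorem continuous_besselSymbol (s : ℝ) :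
    Continuous (besselSymbol s : EuclideanSpace ℝ (Fin d) → ℂ) := by
  refine Complex.continuous_ofReal.comp (Continuous.rpow_const (by fun_prop) fun ξ => Or.inl ?_)
  positivity

theorem norm_besselSymbol_le_one (hs : 0 ≤ s) (ξ : EuclideanSpace ℝ (Fin d)) :
    ‖besselSymbol s ξ‖ ≤ 1 := by
  rw [besselSymbol, Complex.norm_real, Real.norm_of_nonneg (by positivity)]
  exact Real.rpow_le_one_of_one_le_of_nonpos (by nlinarith [sq_nonneg (2 * Real.pi * ‖ξ‖)])
    (by linarith)

theorem norm_besselSymbol_le (hs : 0 ≤ s) {R : ℝ} (hR : 0 < R) {ξ : EuclideanSpace ℝ (Fin d)}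
    (hξ : R ≤ ‖ξ‖) : ‖besselSymbol s ξ‖ ≤ R ^ (-s) := by
  rw [besselSymbol, Complex.norm_real, Real.norm_of_nonneg (by positivity)]
  have h : R ^ (-s) = (R ^ 2) ^ (-(s / 2)) := by
    rw [← Real.rpow_natCast, ← Real.rpow_mul hR.le]
    congr 1
    push_cast
    ring
  rw [h]
  refine Real.rpow_le_rpow_of_nonpos (by positivity) ?_ (by linarith)
  have h1 : R ^ 2 ≤ ‖ξ‖ ^ 2 := by gcongr
  have h2 : 1 ≤ (2 * Real.pi) ^ 2 := by nlinarith [Real.pi_gt_three]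
  rw [mul_pow]
  nlinarith [sq_nonneg ‖ξ‖]

theorem norm_lowBesselSymbol_le_one (hs : 0 ≤ s) (N : ℕ) (ξ : EuclideanSpace ℝ (Fin d)) :
    ‖lowBesselSymbol s N ξ‖ ≤ 1 :=
  (norm_indicator_le_norm_self _ _).trans (norm_besselSymbol_le_one hs ξ)

theorem memLp_besselSymbol (hs : 0 ≤ s) :
    MemLp (besselSymbol s : EuclideanSpace ℝ (Fin d) → ℂ) ∞ volume :=
  memLp_top_of_bound (continuous_besselSymbol s).aestronglyMeasurable 1
    (Eventually.of_forall (norm_besselSymbol_le_one hs))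

theorem memLp_lowBesselSymbol (hs : 0 ≤ s) (N : ℕ) (p : ℝ≥0∞) :
    MemLp (lowBesselSymbol s N : EuclideanSpace ℝ (Fin d) → ℂ) p volume := by
  have h : MemLp (besselSymbol s : EuclideanSpace ℝ (Fin d) → ℂ) p
      (volume.restrict (Metric.ball 0 (2 ^ N))) := by
    have : IsFiniteMeasure (volume.restrict (Metric.ball (0 : EuclideanSpace ℝ (Fin d)) (2 ^ N))) :=
      ⟨by simpa using measure_ball_lt_top⟩
    exact ((memLp_besselSymbol hs).restrict _).mono_exponent le_top
  exact (memLp_indicator_iff_restrict Metric.isOpen_ball.measurableSet).2 h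

/-- The Bessel potential `(1 - Δ)^{-s/2}` on `L²(ℝᵈ)`. -/
def besselPotential (hs : 0 ≤ s) : LTwo d → LTwo d := fourierMul (memLp_besselSymbol hs)

/-- The Bessel potential of the part of frequency less than `2 ^ N`. -/
def lowBesselPotential (hs : 0 ≤ s) (N : ℕ) : LTwo d → LTwo d :=
  fourierMul (memLp_lowBesselSymbol hs N ∞)

theorem besselFourier_besselPotential (hs : 0 ≤ s) (g : LTwo d) :
    besselFourier s (besselPotential hs g) =ᵐ[volume] (𝓕 g : LTwo d) := by
  filter_upwards [coeFn_fourier_fourierMul (memLp_besselSymbol hs) g] with ξ h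
  rw [besselFourier, besselPotential, h, besselSymbol, ← mul_assoc, ← Complex.ofReal_mul,
    ← Real.rpow_add (by positivity)]
  simp

/-- Plancherel. Together with `exists_besselPotential_eq`, this transfers questions on Hˢ to L². -/
theorem hsNorm_besselPotential (hs : 0 ≤ s) (g : LTwo d) :
    hsNorm s (besselPotential hs g) = ‖g‖ := by
  rw [hsNorm, eLpNorm_congr_ae (besselFourier_besselPotential hs g), ← Lp.norm_def,
    Lp.norm_fourier_eq]

theorem memHs_besselPotential (hs : 0 ≤ s) (g : LTwo d) : MemHs s (besselPotential hs g) := by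
  rw [memHs_iff hs, memLp_congr_ae (besselFourier_besselPotential hs g)]
  exact Lp.memLp _

theorem exists_besselPotential_eq (hs : 0 ≤ s) {f : LTwo d} (hf : MemHs s f) :
    ∃ g : LTwo d, besselPotential hs g = f := by
  rw [memHs_iff hs] at hf
  refine ⟨𝓕⁻ (hf.toLp _ : LTwo d), LTwo.ext_fourier ?_⟩
  filter_upwards [coeFn_fourier_fourierMul (memLp_besselSymbol hs) (𝓕⁻ (hf.toLp _ : LTwo d)),
    hf.coeFn_toLp] with ξ h1 h2
  rw [besselPotential, h1, fourier_fourierInv_eq, h2, besselFourier, besselSymbol, ← mul_assoc,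
    ← Complex.ofReal_mul, ← Real.rpow_add (by positivity)]
  simp

theorem norm_lowBesselPotential_le (hs : 0 ≤ s) (N : ℕ) (g : LTwo d) :
    ‖lowBesselPotential hs N g‖ ≤ ‖g‖ :=
  (norm_fourierMul_le (memLp_lowBesselSymbol hs N ∞) (norm_lowBesselSymbol_le_one hs N) g).trans_eq
    (one_mul _)

theorem norm_besselPotential_sub_low_le (hs : 0 ≤ s) (N : ℕ) (g : LTwo d) :
    ‖besselPotential hs g - lowBesselPotential hs N g‖ ≤ ((2 : ℝ) ^ N) ^ (-s) * ‖g‖ := by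
  rw [besselPotential, lowBesselPotential, fourierMul_sub_fourierMul]
  refine norm_fourierMul_le _ (fun ξ => ?_) g
  rw [Pi.sub_apply, lowBesselSymbol]
  by_cases h : ξ ∈ Metric.ball (0 : EuclideanSpace ℝ (Fin d)) (2 ^ N)
  · rw [Set.indicator_of_mem h, sub_self, norm_zero]
    positivity
  · rw [Set.indicator_of_notMem h, sub_zero]
    exact norm_besselSymbol_le hs (by positivity) (by simpa using h)

theorem tendsto_lowBesselPotential (hs : 0 < s) (g : LTwo d) :
    Tendsto (fun N => lowBesselPotential hs.le N g) atTop (𝓝 (besselPotential hs.le g)) := by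
  rw [tendsto_iff_norm_sub_tendsto_zero]
  have h : Tendsto (fun N : ℕ => ((2 : ℝ) ^ N) ^ (-s) * ‖g‖) atTop (𝓝 (0 * ‖g‖)) :=
    ((tendsto_rpow_neg_atTop hs).comp
      (tendsto_pow_atTop_atTop_of_one_lt (by norm_num))).mul_const _
  rw [zero_mul] at h
  refine squeeze_zero (fun _ => norm_nonneg _) (fun N => ?_) h
  rw [norm_sub_rev]
  exact norm_besselPotential_sub_low_le hs.le N g

/-- The kernel of `lowBesselPotential`. -/
def lowBesselKernel (d : ℕ) (hs : 0 ≤ s) (N : ℕ) : LTwo d :=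
  fourierMulKernel (memLp_lowBesselSymbol hs N 2)

theorem coeFn_lowBesselPotential (hs : 0 ≤ s) (N : ℕ) (g : LTwo d) :
    lowBesselPotential hs N g =ᵐ[volume]
      fun x => inner ℂ (lowBesselKernel d hs N) (translateLTwo x g) :=
  coeFn_fourierMul _ _ g

/-- The difference lives on the annulus 2^N ≤ |ξ| < 2^(N+1), where the symbol has decayed to
2^{-Ns}. The indicator of the full outer ball is kept since only its volume, of order 2^{Nd},
enters. -/
theorem norm_dyadic_symbol_le (hs : 0 ≤ s) (N : ℕ) (ξ : EuclideanSpace ℝ (Fin d)) :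
    ‖(lowBesselSymbol s (N + 1) - lowBesselSymbol s N : EuclideanSpace ℝ (Fin d) → ℂ) ξ‖ ≤
      (Metric.ball (0 : EuclideanSpace ℝ (Fin d)) (2 ^ (N + 1))).indicator
        (fun _ => ((2 : ℝ) ^ N) ^ (-s)) ξ := by
  rw [Pi.sub_apply, lowBesselSymbol, lowBesselSymbol]
  have hsub : Metric.ball (0 : EuclideanSpace ℝ (Fin d)) (2 ^ N) ⊆ Metric.ball 0 (2 ^ (N + 1)) :=
    Metric.ball_subset_ball (pow_le_pow_right₀ (by norm_num) (by omega))
  by_cases h1 : ξ ∈ Metric.ball (0 : EuclideanSpace ℝ (Fin d)) (2 ^ N)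
  · rw [Set.indicator_of_mem h1, Set.indicator_of_mem (hsub h1), Set.indicator_of_mem (hsub h1),
      sub_self, norm_zero]
    positivity
  · rw [Set.indicator_of_notMem h1, sub_zero]
    by_cases h2 : ξ ∈ Metric.ball (0 : EuclideanSpace ℝ (Fin d)) (2 ^ (N + 1))
    · rw [Set.indicator_of_mem h2, Set.indicator_of_mem h2]
      exact norm_besselSymbol_le hs (by positivity) (by simpa using h1)
    · rw [Set.indicator_of_notMem h2, Set.indicator_of_notMem h2, norm_zero]

/-- This is the norm of the block's kernel, hence by Cauchy–Schwarz its L² → L^∞ bound, of order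
2^{N(d/2-s)}. -/
theorem eLpNorm_dyadic_symbol_le (hs : 0 ≤ s) (N : ℕ) :
    (eLpNorm (lowBesselSymbol s (N + 1) - lowBesselSymbol s N : EuclideanSpace ℝ (Fin d) → ℂ)
        2 volume).toReal ≤ ((2 : ℝ) ^ N) ^ (-s) * (((2 : ℝ) ^ (N + 1)) ^ ((d : ℝ) / 2) *
      (volume (Metric.ball (0 : EuclideanSpace ℝ (Fin d)) 1)).toReal ^ (1 / 2 : ℝ)) := by
  refine ENNReal.toReal_le_of_le_ofReal (by positivity) ?_
  refine (eLpNorm_mono_real (norm_dyadic_symbol_le hs N)).trans ?_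
  rw [eLpNorm_indicator_const Metric.isOpen_ball.measurableSet (by simp) (by simp),
    Measure.addHaar_ball_of_pos _ _ (by positivity), finrank_euclideanSpace_fin,
    ENNReal.ofReal_mul (by positivity), Real.enorm_of_nonneg (by positivity), ENNReal.toReal_ofNat,
    ENNReal.mul_rpow_of_nonneg _ _ (by norm_num), ENNReal.ofReal_mul (by positivity),
    ENNReal.ofReal_rpow_of_nonneg (by positivity) (by norm_num)]
  have h : (((2 : ℝ) ^ (N + 1)) ^ d) ^ (1 / 2 : ℝ) = ((2 : ℝ) ^ (N + 1)) ^ ((d : ℝ) / 2) := by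
    rw [← Real.rpow_natCast (2 ^ (N + 1)) d, ← Real.rpow_mul (by positivity)]
    congr 1
    ring
  rw [h, ← ENNReal.ofReal_rpow_of_nonneg (x := (volume _).toReal) (by positivity) (by norm_num),
    ENNReal.ofReal_toReal measure_ball_lt_top.ne]

/-- The ratio of the geometric series that controls the high frequencies in `L^q`. -/
def dyadicRatio (d : ℕ) (s q : ℝ) : ℝ := 2 ^ (-s + d / 2 * (1 - 2 / q))

/-- The exponent equals (q(d - 2s) - 2d)/(2q), which is negative exactly below the critical q. -/
theorem dyadicRatio_lt_one {q : ℝ} (hs : s < (d : ℝ) / 2) (hq : 2 < q)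
    (hq' : q < 2 * d / (d - 2 * s)) : dyadicRatio d s q < 1 := by
  refine Real.rpow_lt_one_of_one_lt_of_neg (by norm_num) ?_
  have h1 : 0 < (d : ℝ) - 2 * s := by linarith
  rw [lt_div_iff₀ h1] at hq'
  have h2 : -s + (d : ℝ) / 2 * (1 - 2 / q) = (q * (d - 2 * s) - 2 * d) / (2 * q) := by
    field_simp
    ring
  rw [h2]
  exact div_neg_of_neg_of_pos (by linarith) (by linarith)

/-- Interpolate the L² and sup bounds of a block with weights 1 - θ and θ, where θ = 1 - 2/q. -/
theorem exists_eLpNorm_dyadic_le (d : ℕ) (hs : 0 ≤ s) {q : ℝ} (hq : 2 < q) :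
    ∃ C : ℝ, 0 ≤ C ∧ ∀ (N : ℕ) (g : LTwo d),
      eLpNorm (lowBesselPotential hs (N + 1) g - lowBesselPotential hs N g : LTwo d)
        (ENNReal.ofReal q) volume ≤ ENNReal.ofReal (C * dyadicRatio d s q ^ N * ‖g‖) := by
  have hq0 : 0 < q := by linarith
  set θ : ℝ := 1 - 2 / q with hθ
  have hθ0 : 0 ≤ θ := by
    have : 2 / q < 1 := (div_lt_one hq0).2 hq
    linarith
  have hθ1 : 2 / q = 1 - θ := by rw [hθ]; ring
  set V : ℝ := (volume (Metric.ball (0 : EuclideanSpace ℝ (Fin d)) 1)).toReal ^ (1 / 2 : ℝ)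
  -- What the sup bound leaves, independently of N, after 2^(N+1) is split as 2^N · 2.
  refine ⟨(2 ^ ((d : ℝ) / 2) * V) ^ θ, by positivity, fun N g => ?_⟩
  set m : EuclideanSpace ℝ (Fin d) → ℂ := lowBesselSymbol s (N + 1) - lowBesselSymbol s N
  have hm : MemLp m ∞ volume := (memLp_lowBesselSymbol hs _ _).sub (memLp_lowBesselSymbol hs _ _)
  have hm2 : MemLp m 2 volume := (memLp_lowBesselSymbol hs _ _).sub (memLp_lowBesselSymbol hs _ _)
  set A : ℝ := ((2 : ℝ) ^ N) ^ (-s) with hA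
  have h1 : ‖fourierMul hm g‖ ≤ A * ‖g‖ := norm_fourierMul_le hm (fun ξ =>
    (norm_dyadic_symbol_le hs N ξ).trans
      (Set.indicator_le_self' (fun _ _ => by positivity) ξ)) g
  have h2 : ∀ᵐ x, ‖fourierMul hm g x‖ ≤ A * (((2 : ℝ) ^ (N + 1)) ^ ((d : ℝ) / 2) * V) * ‖g‖ := by
    filter_upwards [coeFn_fourierMul hm hm2 g] with x hx
    rw [hx]
    refine (norm_inner_le_norm _ _).trans ?_
    rw [norm_translateLTwo, norm_fourierMulKernel]
    gcongr
    exact eLpNorm_dyadic_symbol_le hs N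
  rw [lowBesselPotential, lowBesselPotential, fourierMul_sub_fourierMul]
  refine (LTwo.eLpNorm_le_of_bound hq h1 (by positivity) h2).trans (le_of_eq ?_)
  congr 1
  have hg : ‖g‖ = ‖g‖ ^ (1 - θ) * ‖g‖ ^ θ := by
    rw [← Real.rpow_add_of_nonneg (norm_nonneg g) (by rw [← hθ1]; positivity) hθ0]
    simp
  have hA' : A = A ^ (1 - θ) * A ^ θ := by
    rw [← Real.rpow_add (by positivity)]
    simp
  have hr : dyadicRatio d s q ^ N = A * ((2 ^ N : ℝ) ^ ((d : ℝ) / 2)) ^ θ := by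
    have e1 : ((2 : ℝ) ^ (-s + d / 2 * θ)) ^ N = 2 ^ ((-s + d / 2 * θ) * N) := by
      rw [← Real.rpow_natCast, ← Real.rpow_mul (by norm_num)]
    have e2 : A = 2 ^ (N * -s) := by
      rw [hA, ← Real.rpow_natCast, ← Real.rpow_mul (by norm_num)]
    have e3 : ((2 ^ N : ℝ) ^ ((d : ℝ) / 2)) ^ θ = 2 ^ (N * ((d : ℝ) / 2 * θ)) := by
      rw [← Real.rpow_natCast, ← Real.rpow_mul (by norm_num), ← Real.rpow_mul (by norm_num)]
    rw [dyadicRatio, ← hθ, e1, e2, e3, ← Real.rpow_add (by norm_num)]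
    congr 1
    ring
  rw [← hθ, hr, hθ1, pow_succ, Real.mul_rpow (x := (2 : ℝ) ^ N) (by positivity) (by norm_num)]
  have : (A * ‖g‖) ^ (1 - θ) * (A * ((2 ^ N) ^ ((d : ℝ) / 2) * 2 ^ ((d : ℝ) / 2) * V) * ‖g‖) ^ θ =
      (A ^ (1 - θ) * A ^ θ) * (‖g‖ ^ (1 - θ) * ‖g‖ ^ θ) *
        ((((2 ^ N) ^ ((d : ℝ) / 2)) ^ θ) * (2 ^ ((d : ℝ) / 2) * V) ^ θ) := by
    rw [Real.mul_rpow (by positivity) (by positivity), Real.mul_rpow (by positivity) (by positivity),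
      Real.mul_rpow (by positivity) (by positivity), mul_assoc ((2 ^ N : ℝ) ^ ((d : ℝ) / 2)),
      Real.mul_rpow (x := (2 ^ N : ℝ) ^ ((d : ℝ) / 2)) (by positivity) (by positivity)]
    ring
  rw [this, ← hA', ← hg]
  ring

/-- In the subcritical range, the high frequencies are small in `L^q`, uniformly on bounded sets
of `Hˢ`. -/
theorem exists_eLpNorm_besselPotential_sub_low_le (hs0 : 0 < s) (hs : s < (d : ℝ) / 2) {q : ℝ}
    (hq : 2 < q) (hq' : q < 2 * d / (d - 2 * s)) :
    ∃ τ : ℕ → ℝ, (∀ K, 0 ≤ τ K) ∧ Tendsto τ atTop (𝓝 0) ∧ ∀ (K : ℕ) (g : LTwo d),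
      eLpNorm (besselPotential hs0.le g - lowBesselPotential hs0.le K g : LTwo d)
        (ENNReal.ofReal q) volume ≤ ENNReal.ofReal (τ K * ‖g‖) := by
  obtain ⟨C, hC0, hC⟩ := exists_eLpNorm_dyadic_le d hs0.le hq
  have ha1 := dyadicRatio_lt_one hs hq hq'
  have ha0 : 0 < dyadicRatio d s q := by unfold dyadicRatio; positivity
  set a := dyadicRatio d s q
  have h1a : 0 < 1 - a := by linarith
  refine ⟨fun K => C * (a ^ K / (1 - a)), fun K => by positivity, ?_, fun K g => ?_⟩
  · simpa using ((tendsto_pow_atTop_nhds_zero_of_lt_one ha0.le ha1).div_const (1 - a)).const_mul C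
  -- Keeping the exact partial geometric sum makes the induction close with equality.
  have hsum : ∀ n : ℕ, eLpNorm
      (lowBesselPotential hs0.le (K + n) g - lowBesselPotential hs0.le K g : LTwo d)
        (ENNReal.ofReal q) volume ≤ ENNReal.ofReal (C * ((a ^ K - a ^ (K + n)) / (1 - a)) * ‖g‖) := by
    intro n
    induction n with
    | zero =>
      rw [add_zero, sub_self, eLpNorm_congr_ae (Lp.coeFn_zero _ _ _)]
      simp
    | succ n ih =>
      have heq : (lowBesselPotential hs0.le (K + (n + 1)) g - lowBesselPotential hs0.le K g : LTwo d)
          = (lowBesselPotential hs0.le (K + n) g - lowBesselPotential hs0.le K g : LTwo d) +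
            (lowBesselPotential hs0.le (K + n + 1) g - lowBesselPotential hs0.le (K + n) g) := by
        rw [add_assoc K n 1]
        abel
      rw [heq, eLpNorm_congr_ae (Lp.coeFn_add _ _)]
      refine (eLpNorm_add_le (Lp.aestronglyMeasurable _) (Lp.aestronglyMeasurable _)
        (ENNReal.one_le_ofReal.2 (by linarith))).trans ((add_le_add ih (hC (K + n) g)).trans ?_)
      have hpow : a ^ (K + n) ≤ a ^ K := pow_le_pow_of_le_one ha0.le ha1.le (by omega)
      rw [← ENNReal.ofReal_add]
      · refine ENNReal.ofReal_le_ofReal (le_of_eq ?_)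
        field_simp
        ring
      · have : 0 ≤ a ^ K - a ^ (K + n) := by linarith
        positivity
      · positivity
  have hlim : Tendsto (fun n : ℕ => lowBesselPotential hs0.le (K + n) g -
      lowBesselPotential hs0.le K g) atTop
      (𝓝 (besselPotential hs0.le g - lowBesselPotential hs0.le K g)) := by
    refine Tendsto.sub_const ((tendsto_lowBesselPotential hs0 g).comp ?_) _
    exact tendsto_atTop_mono (fun n => Nat.le_add_left n K) tendsto_id
  -- L² convergence gives a.e. convergence of a subsequence, and Fatou then passes the L^q bound to
  -- the limit.
  obtain ⟨ns, hns, hae⟩ := (tendstoInMeasure_of_tendsto_Lp hlim).exists_seq_tendsto_ae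
  refine Lp.eLpNorm_le_of_ae_tendsto (u := atTop) (Eventually.of_forall fun n => ?_)
    (fun n => Lp.aestronglyMeasurable _) hae
  refine (hsum (ns n)).trans (ENNReal.ofReal_le_ofReal ?_)
  have : 0 < a ^ (K + ns n) := by positivity
  change C * ((a ^ K - a ^ (K + ns n)) / (1 - a)) * ‖g‖ ≤ C * (a ^ K / (1 - a)) * ‖g‖
  gcongr
  linarith

theorem norm_lowBesselPotential_ae_le (hs : 0 ≤ s) (K : ℕ) (g : LTwo d) :
    ∀ᵐ x, ‖lowBesselPotential hs K g x‖ ≤ ‖lowBesselKernel d hs K‖ * ‖g‖ := by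
  filter_upwards [coeFn_lowBesselPotential hs K g] with x hx
  rw [hx]
  refine (norm_inner_le_norm _ _).trans_eq ?_
  rw [norm_translateLTwo]

theorem memLp_lowBesselPotential (hs : 0 ≤ s) {q : ℝ} (hq : 2 < q) (K : ℕ) (g : LTwo d) :
    MemLp (lowBesselPotential hs K g) (ENNReal.ofReal q) volume :=
  ⟨Lp.aestronglyMeasurable _, (LTwo.eLpNorm_le_of_bound hq le_rfl (by positivity)
    (norm_lowBesselPotential_ae_le hs K g)).trans_lt ENNReal.ofReal_lt_top⟩

/-- The subcritical Sobolev embedding. -/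
theorem exists_eLpNorm_besselPotential_le (hs0 : 0 < s) (hs : s < (d : ℝ) / 2) {q : ℝ}
    (hq : 2 < q) (hq' : q < 2 * d / (d - 2 * s)) :
    ∃ C : ℝ, 0 ≤ C ∧ ∀ g : LTwo d, eLpNorm (besselPotential hs0.le g) (ENNReal.ofReal q) volume ≤
      ENNReal.ofReal (C * ‖g‖) := by
  obtain ⟨τ, hτ0, -, hτ⟩ := exists_eLpNorm_besselPotential_sub_low_le hs0 hs hq hq'
  set B := ‖lowBesselKernel d hs0.le 0‖
  -- Cut at frequency 2^0: the tail costs `τ 0`, and the low part interpolates between ‖g‖ in L² and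
  -- B‖g‖ in L^∞.
  refine ⟨τ 0 + B ^ (1 - 2 / q), add_nonneg (hτ0 0) (by positivity), fun g => ?_⟩
  have heq : besselPotential hs0.le g =
      (besselPotential hs0.le g - lowBesselPotential hs0.le 0 g) + lowBesselPotential hs0.le 0 g := by
    abel
  rw [heq, eLpNorm_congr_ae (Lp.coeFn_add _ _)]
  refine (eLpNorm_add_le (Lp.aestronglyMeasurable _) (Lp.aestronglyMeasurable _)
    (ENNReal.one_le_ofReal.2 (by linarith))).trans ?_
  rw [add_mul, ENNReal.ofReal_add (mul_nonneg (hτ0 0) (norm_nonneg g)) (by positivity)]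
  refine add_le_add (hτ 0 g) ((LTwo.eLpNorm_le_of_bound hq (norm_lowBesselPotential_le hs0.le 0 g)
    (by positivity) (norm_lowBesselPotential_ae_le hs0.le 0 g)).trans_eq ?_)
  have : 2 / q < 1 := (div_lt_one (by linarith)).2 hq
  have hg : ‖g‖ = ‖g‖ ^ (2 / q) * ‖g‖ ^ (1 - 2 / q) := by
    rw [← Real.rpow_add_of_nonneg (norm_nonneg g) (by positivity) (by linarith)]
    simp
  rw [Real.mul_rpow (norm_nonneg _) (norm_nonneg g)]
  congr 1
  conv_rhs => rw [hg]
  ring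

theorem memLp_besselPotential (hs0 : 0 < s) (hs : s < (d : ℝ) / 2) {q : ℝ}
    (hq : 2 < q) (hq' : q < 2 * d / (d - 2 * s)) (g : LTwo d) :
    MemLp (besselPotential hs0.le g) (ENNReal.ofReal q) volume := by
  obtain ⟨C, -, hC⟩ := exists_eLpNorm_besselPotential_le hs0 hs hq hq'
  exact ⟨Lp.aestronglyMeasurable _, (hC g).trans_lt ENNReal.ofReal_lt_top⟩

end BesselPotential

/-! ### Brezis–Lieb decoupling in L^q -/

section BrezisLieb

theorem toReal_eLpNorm_rpow_eq_integral {α F : Type*} [MeasurableSpace α] {μ : Measure α}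
    [NormedAddCommGroup F] {q : ℝ} (hq : 0 < q) {f : α → F}
    (hf : MemLp f (ENNReal.ofReal q) μ) :
    (eLpNorm f (ENNReal.ofReal q) μ).toReal ^ q = ∫ x, ‖f x‖ ^ q ∂μ := by
  have h0 : 0 ≤ ∫ x, ‖f x‖ ^ q ∂μ := integral_nonneg fun x => by positivity
  rw [hf.eLpNorm_eq_integral_rpow_norm (by simpa using hq) (by simp), ENNReal.toReal_ofReal hq.le,
    ENNReal.toReal_ofReal (by positivity), ← Real.rpow_mul h0, inv_mul_cancel₀ hq.ne',
    Real.rpow_one]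

theorem abs_toReal_eLpNorm_sub_le {α F : Type*} [MeasurableSpace α] {μ : Measure α}
    [NormedAddCommGroup F] {p : ℝ≥0∞} (hp : 1 ≤ p) {f g : α → F} (hf : MemLp f p μ)
    (hg : MemLp g p μ) :
    |(eLpNorm f p μ).toReal - (eLpNorm g p μ).toReal| ≤ (eLpNorm (f - g) p μ).toReal := by
  have key : ∀ {f g : α → F}, MemLp f p μ → MemLp g p μ →
      (eLpNorm f p μ).toReal ≤ (eLpNorm (f - g) p μ).toReal + (eLpNorm g p μ).toReal := by
    intro f g hf hg
    rw [← ENNReal.toReal_add (hf.sub hg).eLpNorm_ne_top hg.eLpNorm_ne_top]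
    refine ENNReal.toReal_mono
      (ENNReal.add_ne_top.2 ⟨(hf.sub hg).eLpNorm_ne_top, hg.eLpNorm_ne_top⟩) ?_
    simpa using eLpNorm_add_le (hf.sub hg).1 hg.1 hp
  rw [abs_sub_le_iff]
  constructor
  · linarith [key hf hg]
  · have := key hg hf
    rw [eLpNorm_sub_comm] at this
    linarith

variable {d : ℕ} {q : ℝ}

/-- The integrand |v + l_n|^q - |v|^q - |l_n|^q vanishes off the compact support of v and is bounded
by a constant on it, so dominated convergence applies. -/
theorem tendsto_eLpNorm_rpow_add_sub_of_bounded (hq : 1 ≤ q) {v : EuclideanSpace ℝ (Fin d) → ℂ}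
    (hvc : Continuous v) (hvs : HasCompactSupport v) (hv : MemLp v (ENNReal.ofReal q) volume)
    {l : ℕ → EuclideanSpace ℝ (Fin d) → ℂ} {M : ℝ}
    (hl : ∀ n, MemLp (l n) (ENNReal.ofReal q) volume) (hM : ∀ n, ∀ᵐ x, ‖l n x‖ ≤ M)
    (hlim : ∀ᵐ x, Tendsto (fun n => l n x) atTop (𝓝 0)) :
    Tendsto (fun n => (eLpNorm (v + l n) (ENNReal.ofReal q) volume).toReal ^ q -
      (eLpNorm v (ENNReal.ofReal q) volume).toReal ^ q -
      (eLpNorm (l n) (ENNReal.ofReal q) volume).toReal ^ q) atTop (𝓝 0) := by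
  have hq0 : 0 < q := by linarith
  have hint : ∀ {f : EuclideanSpace ℝ (Fin d) → ℂ}, MemLp f (ENNReal.ofReal q) volume →
      Integrable (fun x => ‖f x‖ ^ q) volume := by
    intro f hf
    simpa [ENNReal.toReal_ofReal hq0.le] using
      hf.integrable_norm_rpow (by simpa using hq0) (by simp)
  have heq : ∀ n, (eLpNorm (v + l n) (ENNReal.ofReal q) volume).toReal ^ q -
      (eLpNorm v (ENNReal.ofReal q) volume).toReal ^ q -
      (eLpNorm (l n) (ENNReal.ofReal q) volume).toReal ^ q =
      ∫ x, (‖(v + l n) x‖ ^ q - ‖v x‖ ^ q - ‖l n x‖ ^ q) := by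
    intro n
    have h := integral_sub ((hint (hv.add (hl n))).sub (hint hv)) (hint (hl n))
    simp only [Pi.sub_apply] at h
    rw [h, integral_sub (hint (hv.add (hl n))) (hint hv),
      toReal_eLpNorm_rpow_eq_integral hq0 (hv.add (hl n)), toReal_eLpNorm_rpow_eq_integral hq0 hv,
      toReal_eLpNorm_rpow_eq_integral hq0 (hl n)]
  simp_rw [heq]
  obtain ⟨c, hc⟩ := hvs.exists_bound_of_continuous hvc
  rw [← integral_zero (EuclideanSpace ℝ (Fin d)) ℝ (μ := volume)]
  refine tendsto_integral_of_dominated_convergence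
    ((tsupport v).indicator fun _ => (c + M) ^ q + c ^ q + M ^ q)
    (fun n => (((hint (hv.add (hl n))).sub (hint hv)).sub (hint (hl n))).1) ?_ (fun n => ?_) ?_
  · rw [integrable_indicator_iff (isClosed_tsupport v).measurableSet]
    exact integrableOn_const hvs.measure_lt_top.ne
  · filter_upwards [hM n] with x hx
    by_cases hxs : x ∈ tsupport v
    · rw [Set.indicator_of_mem hxs]
      have h1 : ‖(v + l n) x‖ ^ q ≤ (c + M) ^ q := by
        gcongr
        exact (norm_add_le _ _).trans (add_le_add (hc x) hx)
      have h2 : ‖v x‖ ^ q ≤ c ^ q := by gcongr; exact hc x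
      have h3 : ‖l n x‖ ^ q ≤ M ^ q := by gcongr
      have h4 : 0 ≤ ‖(v + l n) x‖ ^ q := by positivity
      have h5 : 0 ≤ ‖v x‖ ^ q := by positivity
      have h6 : 0 ≤ ‖l n x‖ ^ q := by positivity
      rw [Real.norm_eq_abs, abs_le]
      constructor <;> linarith
    · rw [Set.indicator_of_notMem hxs, Pi.add_apply, image_eq_zero_of_notMem_tsupport hxs]
      simp [Real.zero_rpow hq0.ne']
  · filter_upwards [hlim] with x hx
    have h1 : Tendsto (fun n => ‖(v + l n) x‖ ^ q) atTop (𝓝 (‖v x + 0‖ ^ q)) :=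
      ((hx.const_add (v x)).norm).rpow_const (Or.inr hq0.le)
    have h2 : Tendsto (fun n => ‖l n x‖ ^ q) atTop (𝓝 (‖(0 : ℂ)‖ ^ q)) :=
      hx.norm.rpow_const (Or.inr hq0.le)
    have h3 := (h1.sub_const (‖v x‖ ^ q)).sub h2
    simpa [Real.zero_rpow hq0.ne'] using h3

/-- A version of the Brezis–Lieb lemma for bounded sequences of `L^q` that are, up to errors small
in `L^q`, bounded and convergent to zero almost everywhere. -/
theorem tendsto_eLpNorm_rpow_add_sub (hq : 1 ≤ q) {v : EuclideanSpace ℝ (Fin d) → ℂ}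
    (hv : MemLp v (ENNReal.ofReal q) volume) {f : ℕ → EuclideanSpace ℝ (Fin d) → ℂ} {A : ℝ}
    (hf : ∀ n, MemLp (f n) (ENNReal.ofReal q) volume)
    (hA : ∀ n, (eLpNorm (f n) (ENNReal.ofReal q) volume).toReal ≤ A)
    (happrox : ∀ ε > 0, ∃ (l : ℕ → EuclideanSpace ℝ (Fin d) → ℂ) (M : ℝ),
      (∀ n, MemLp (l n) (ENNReal.ofReal q) volume) ∧ (∀ n, ∀ᵐ x, ‖l n x‖ ≤ M) ∧
      (∀ᵐ x, Tendsto (fun n => l n x) atTop (𝓝 0)) ∧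
      ∀ n, (eLpNorm (f n - l n) (ENNReal.ofReal q) volume).toReal ≤ ε) :
    Tendsto (fun n => (eLpNorm (v + f n) (ENNReal.ofReal q) volume).toReal ^ q -
      (eLpNorm v (ENNReal.ofReal q) volume).toReal ^ q -
      (eLpNorm (f n) (ENNReal.ofReal q) volume).toReal ^ q) atTop (𝓝 0) := by
  have hp : 1 ≤ ENNReal.ofReal q := ENNReal.one_le_ofReal.2 hq
  set p := ENNReal.ofReal q
  set V := (eLpNorm v p volume).toReal
  have hV0 : 0 ≤ V := ENNReal.toReal_nonneg
  have hA0 : 0 ≤ A := ENNReal.toReal_nonneg.trans (hA 0)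
  have huc : UniformContinuousOn (fun t : ℝ => t ^ q) (Set.Icc 0 (V + A + 1)) :=
    isCompact_Icc.uniformContinuousOn_of_continuous
      (Real.continuous_rpow_const (by linarith)).continuousOn
  rw [Metric.uniformContinuousOn_iff] at huc
  rw [Metric.tendsto_atTop]
  intro ε hε
  obtain ⟨δ, hδ, hδε⟩ := huc (ε / 4) (by positivity)
  -- `2 * η < δ` serves uniform continuity; `2 * η ≤ 1` keeps the approximants' norms in [0, V + A +
  -- 1].
  set η := min (δ / 3) (1 / 2)
  have hη : 0 < η := by positivity
  have hη1 : 2 * η < δ := by have := min_le_left (δ / 3) (1 / 2); linarith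
  have hη2 : 2 * η ≤ 1 := by have := min_le_right (δ / 3) (1 / 2); linarith
  obtain ⟨w, hws, hwv, hwc, hw⟩ := hv.exists_hasCompactSupport_eLpNorm_sub_le (ε := ENNReal.ofReal η)
    (by simp [p]) (by simpa using hη)
  have hwv' : (eLpNorm (v - w) p volume).toReal ≤ η := ENNReal.toReal_le_of_le_ofReal hη.le hwv
  obtain ⟨l, M, hl, hM, hlim, hfl⟩ := happrox η hη
  have h0 := tendsto_eLpNorm_rpow_add_sub_of_bounded hq hwc hws hw hl hM hlim
  rw [Metric.tendsto_atTop] at h0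
  obtain ⟨N, hN⟩ := h0 (ε / 4) (by positivity)
  refine ⟨N, fun n hn => ?_⟩
  have hclose : ∀ {g h : EuclideanSpace ℝ (Fin d) → ℂ}, MemLp g p volume → MemLp h p volume →
      (eLpNorm g p volume).toReal ≤ V + A → (eLpNorm (g - h) p volume).toReal ≤ 2 * η →
      |(eLpNorm g p volume).toReal ^ q - (eLpNorm h p volume).toReal ^ q| < ε / 4 := by
    intro g h hg hh hgV hgh
    have h1 := (abs_toReal_eLpNorm_sub_le hp hg hh).trans hgh
    have h2 := abs_le.1 h1
    exact hδε _ ⟨ENNReal.toReal_nonneg, by linarith⟩ _ ⟨ENNReal.toReal_nonneg, by linarith⟩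
      (h1.trans_lt hη1)
  have hadd : ∀ {g h : EuclideanSpace ℝ (Fin d) → ℂ}, MemLp g p volume → MemLp h p volume →
      (eLpNorm (g + h) p volume).toReal ≤
        (eLpNorm g p volume).toReal + (eLpNorm h p volume).toReal := by
    intro g h hg hh
    rw [← ENNReal.toReal_add hg.eLpNorm_ne_top hh.eLpNorm_ne_top]
    exact ENNReal.toReal_mono (ENNReal.add_ne_top.2 ⟨hg.eLpNorm_ne_top, hh.eLpNorm_ne_top⟩)
      (eLpNorm_add_le hg.1 hh.1 hp)
  -- Replacing v by w and f_n by l_n in each of the three terms costs ε/4, as does the limit for (w,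
  -- l_n).
  have c1 := hclose (hv.add (hf n)) (hw.add (hl n))
    ((hadd hv (hf n)).trans (by linarith [hA n])) (by
      rw [add_sub_add_comm]
      refine (hadd (hv.sub hw) ((hf n).sub (hl n))).trans ?_
      linarith [hfl n])
  have c2 := hclose hv hw (by linarith) (by linarith)
  have c3 := hclose (hf n) (hl n) (by linarith [hA n]) (by linarith [hfl n])
  have c4 := hN n hn
  rw [Real.dist_eq, sub_zero] at c4 ⊢
  rw [abs_lt] at *
  constructor <;> linarith

variable {s : ℝ}

/-- Decoupling in `L^q` of a fixed profile and a sequence converging weakly to zero in `Hˢ`. -/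
theorem tendsto_lqNorm_rpow_besselPotential_add_sub (hs0 : 0 < s) (hs : s < (d : ℝ) / 2)
    (hq : 2 < q) (hq' : q < 2 * d / (d - 2 * s)) (g : LTwo d) {e : ℕ → LTwo d} {A : ℝ}
    (hA : ∀ n, ‖e n‖ ≤ A) (he : ∀ h : LTwo d, Tendsto (fun n => inner ℂ h (e n)) atTop (𝓝 0)) :
    Tendsto (fun n => lqNorm q (besselPotential hs0.le g + besselPotential hs0.le (e n)) ^ q -
      lqNorm q (besselPotential hs0.le g) ^ q - lqNorm q (besselPotential hs0.le (e n)) ^ q)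
      atTop (𝓝 0) := by
  obtain ⟨C, hC0, hC⟩ := exists_eLpNorm_besselPotential_le hs0 hs hq hq'
  obtain ⟨τ, hτ0, hτlim, hτ⟩ := exists_eLpNorm_besselPotential_sub_low_le hs0 hs hq hq'
  have hA0 : 0 ≤ A := (norm_nonneg _).trans (hA 0)
  have h := tendsto_eLpNorm_rpow_add_sub (q := q) (A := C * A) (by linarith)
    (memLp_besselPotential hs0 hs hq hq' g)
    (fun n => memLp_besselPotential hs0 hs hq hq' (e n)) (fun n => ?_) (fun ε hε => ?_)
  · refine h.congr fun n => ?_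
    rw [lqNorm, lqNorm, lqNorm, eLpNorm_congr_ae (Lp.coeFn_add _ _)]
  · refine ENNReal.toReal_le_of_le_ofReal (by positivity) ((hC (e n)).trans ?_)
    exact ENNReal.ofReal_le_ofReal (by gcongr; exact hA n)
  · have hK := (hτlim.mul_const A).eventually_lt_const (u := ε) (by simpa using hε)
    obtain ⟨K, hK⟩ := hK.exists
    -- The low-frequency part is bounded by Cauchy–Schwarz and tends to zero pointwise by weak
    -- convergence against the translated kernel.
    refine ⟨fun n => lowBesselPotential hs0.le K (e n), ‖lowBesselKernel d hs0.le K‖ * A,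
      fun n => memLp_lowBesselPotential hs0.le hq K (e n), fun n => ?_, ?_, fun n => ?_⟩
    · filter_upwards [norm_lowBesselPotential_ae_le hs0.le K (e n)] with x hx
      exact hx.trans (by gcongr; exact hA n)
    · filter_upwards [ae_all_iff.2 fun n => coeFn_lowBesselPotential hs0.le K (e n)] with x hx
      simp_rw [hx]
      refine (he (translateLTwo (-x) (lowBesselKernel d hs0.le K))).congr fun n => ?_
      rw [inner_translateLTwo_left, neg_neg]
    · refine ENNReal.toReal_le_of_le_ofReal hε.le ?_
      rw [← eLpNorm_congr_ae (Lp.coeFn_sub _ _)]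
      refine (hτ K (e n)).trans (ENNReal.ofReal_le_ofReal (le_trans ?_ hK.le))
      have := hτ0 K
      gcongr
      exact hA n

end BrezisLieb

/-! ### Weak limits along ultrafilters and extraction of subsequences -/

section WeakLimits

variable {H : Type*} [NormedAddCommGroup H] [InnerProductSpace ℂ H]

/-- Banach–Alaoglu on the dual; an ultrafilter on a compact set converges, so no subsequence is
needed. -/
theorem exists_weak_limit_of_bounded [CompleteSpace H] (U : Ultrafilter ℕ) {f : ℕ → H} {A : ℝ}
    (hA : ∀ n, ‖f n‖ ≤ A) :
    ∃ ψ : H, ∀ h, Tendsto (fun n => inner ℂ h (f n)) U (𝓝 (inner ℂ h ψ)) := by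
  let F : ℕ → WeakDual ℂ H := fun n =>
    WeakDual.toStrongDual.symm (InnerProductSpace.toDual ℂ H (f n))
  have hmem : ((U.map F : Ultrafilter _) : Filter (WeakDual ℂ H)) ≤
      𝓟 (WeakDual.toStrongDual ⁻¹' Metric.closedBall 0 A) := by
    rw [Ultrafilter.coe_map, le_principal_iff, mem_map]
    refine Filter.univ_mem' fun n => ?_
    simp only [Set.mem_preimage, F, LinearEquiv.apply_symm_apply, mem_closedBall_zero_iff,
      LinearIsometryEquiv.norm_map]
    exact hA n
  obtain ⟨φ, -, hφ⟩ := (WeakDual.isCompact_closedBall (𝕜 := ℂ) (0 : StrongDual ℂ H)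
    A).ultrafilter_le_nhds _ hmem
  have hφ' : Tendsto F U (𝓝 φ) := hφ
  refine ⟨(InnerProductSpace.toDual ℂ H).symm (WeakDual.toStrongDual φ), fun h => ?_⟩
  have h1 : Tendsto (fun n => F n h) U (𝓝 (φ h)) :=
    ((WeakDual.eval_continuous h).tendsto φ).comp hφ'
  -- The functional `F n` pairs as ⟨f n, h⟩, the conjugate of the coefficient sought.
  rw [← inner_conj_symm, InnerProductSpace.toDual_symm_apply]
  refine ((Complex.continuous_conj.tendsto _).comp h1).congr fun n => ?_
  rw [Function.comp_apply, ← inner_conj_symm h]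
  rfl

theorem norm_le_of_weak_limit {ι : Type*} {l : Filter ι} [l.NeBot] {f : ι → H} {ψ : H} {A : ℝ}
    (hA : ∀ n, ‖f n‖ ≤ A)
    (h : ∀ h, Tendsto (fun n => inner ℂ h (f n)) l (𝓝 (inner ℂ h ψ))) : ‖ψ‖ ≤ A := by
  have h1 : ‖(inner ℂ ψ ψ : ℂ)‖ ≤ ‖ψ‖ * A := le_of_tendsto (h ψ).norm (Eventually.of_forall
    fun n => (norm_inner_le_norm _ _).trans (by gcongr; exact hA n))
  rw [inner_self_eq_norm_sq_to_K] at h1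
  simp only [Complex.coe_algebraMap, norm_pow, Complex.norm_real, norm_norm] at h1
  by_contra hlt
  push Not at hlt
  have hA0 : 0 < ‖ψ‖ := by
    obtain ⟨n⟩ := l.nonempty_of_neBot
    exact ((norm_nonneg _).trans (hA n)).trans_lt hlt
  nlinarith

/-- Reduces weak convergence to countably many conditions, which one subsequence can meet. -/
theorem tendsto_inner_zero_of_dense {f : ℕ → H} {A : ℝ} (hA : ∀ n, ‖f n‖ ≤ A) {e : ℕ → H}
    (he : DenseRange e) (h : ∀ k, Tendsto (fun n => inner ℂ (e k) (f n)) atTop (𝓝 0)) (g : H) :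
    Tendsto (fun n => inner ℂ g (f n)) atTop (𝓝 0) := by
  have hA0 : 0 ≤ A := (norm_nonneg _).trans (hA 0)
  rw [Metric.tendsto_atTop]
  intro ε hε
  obtain ⟨k, hk⟩ := he.exists_dist_lt g (ε := ε / 2 / (A + 1)) (by positivity)
  obtain ⟨N, hN⟩ := Metric.tendsto_atTop.1 (h k) (ε / 2) (by positivity)
  refine ⟨N, fun n hn => ?_⟩
  have h1 := hN n hn
  rw [dist_zero_right] at h1 ⊢
  rw [dist_eq_norm_sub] at hk
  have h2 : ‖inner ℂ (g - e k) (f n)‖ ≤ ε / 2 := by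
    refine (norm_inner_le_norm _ _).trans ?_
    calc ‖g - e k‖ * ‖f n‖ ≤ ε / 2 / (A + 1) * (A + 1) := by
          gcongr
          linarith [hA n]
      _ = ε / 2 := by field_simp
  have h3 : inner ℂ g (f n) = inner ℂ (g - e k) (f n) + inner ℂ (e k) (f n) := by
    rw [← inner_add_left, sub_add_cancel]
  rw [h3]
  linarith [norm_add_le (inner ℂ (g - e k) (f n)) (inner ℂ (e k) (f n))]

/-- Replaces diagonal extraction: U refines both F and `atTop`, so their infimum is nontrivial, and
F is countably generated. -/
theorem exists_strictMono_tendsto (U : Ultrafilter ℕ) (hU : (U : Filter ℕ) ≤ atTop)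
    {F : Filter ℕ} [F.IsCountablyGenerated] (hF : (U : Filter ℕ) ≤ F) :
    ∃ φ : ℕ → ℕ, StrictMono φ ∧ Tendsto φ atTop F := by
  have : (F ⊓ map id atTop).NeBot := by
    rw [map_id]
    exact U.neBot.mono (le_inf hF hU)
  exact subseq_tendsto_of_neBot this

/-- With F J the energy of the J-th remainder and c J that of the J-th profile, both decouplings
reduce to one extraction. -/
theorem tendsto_telescope {l : Filter ℕ} {F : ℕ → ℕ → ℝ} {c : ℕ → ℝ}
    (h : ∀ J, Tendsto (fun n => F J n - c J - F (J + 1) n) l (𝓝 0)) (J : ℕ) :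
    Tendsto (fun n => F 0 n - (∑ j ∈ Finset.range J, c j + F J n)) l (𝓝 0) := by
  induction J with
  | zero => simpa using (tendsto_const_nhds : Tendsto (fun _ : ℕ => (0 : ℝ)) l (𝓝 0))
  | succ J ih =>
    have := ih.add (h J)
    rw [add_zero] at this
    refine this.congr fun n => ?_
    rw [Finset.sum_range_succ]
    ring

theorem exists_tendsto_of_bounded (U : Ultrafilter ℕ) {t : ℕ → ℝ} {B : ℝ}
    (ht : ∀ n, |t n| ≤ B) : ∃ σ, Tendsto t U (𝓝 σ) := by
  have hmem : ((U.map t : Ultrafilter ℝ) : Filter ℝ) ≤ 𝓟 (Set.Icc (-B) B) := by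
    rw [Ultrafilter.coe_map, le_principal_iff, mem_map]
    exact Filter.univ_mem' fun n => abs_le.1 (ht n)
  obtain ⟨σ, -, hσ⟩ := isCompact_Icc.ultrafilter_le_nhds _ hmem
  exact ⟨σ, hσ⟩

end WeakLimits

/-! ### Greedy extraction of profiles in L² -/

section Profiles

variable {d : ℕ}

theorem inner_translateLTwo_neg (h f : LTwo d) (a : EuclideanSpace ℝ (Fin d)) :
    inner ℂ h (translateLTwo (-a) f) = inner ℂ (translateLTwo a h) f :=
  (inner_translateLTwo_left a h f).symm

theorem translateLTwo_zero_right (a : EuclideanSpace ℝ (Fin d)) :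
    translateLTwo a (0 : LTwo d) = 0 := by
  simpa using translateLTwo_sub a (0 : LTwo d) 0

/-- `ψ` is a weak limit, along the ultrafilter `U`, of translates of the sequence `ρ`. -/
def IsProfile (U : Ultrafilter ℕ) (ρ : ℕ → LTwo d) (ψ : LTwo d) : Prop :=
  ∃ y : ℕ → EuclideanSpace ℝ (Fin d),
    ∀ h, Tendsto (fun n => inner ℂ h (translateLTwo (-y n) (ρ n))) U (𝓝 (inner ℂ h ψ))

theorem exists_isProfile (U : Ultrafilter ℕ) {ρ : ℕ → LTwo d} {A : ℝ} (hA : ∀ n, ‖ρ n‖ ≤ A)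
    (y : ℕ → EuclideanSpace ℝ (Fin d)) : ∃ ψ : LTwo d,
      ∀ h, Tendsto (fun n => inner ℂ h (translateLTwo (-y n) (ρ n))) U (𝓝 (inner ℂ h ψ)) :=
  exists_weak_limit_of_bounded U (A := A) fun n => by
    rw [norm_translateLTwo]
    exact hA n

/-- The norms of profiles are bounded by A; the supremum need not be attained, so a profile above
half of it is taken, or any profile if it is zero. -/
theorem exists_almost_maximal_profile (U : Ultrafilter ℕ) {ρ : ℕ → LTwo d}
    (hρ : ∃ A, ∀ n, ‖ρ n‖ ≤ A) :
    ∃ (ψ : LTwo d) (y : ℕ → EuclideanSpace ℝ (Fin d)),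
      (∀ h, Tendsto (fun n => inner ℂ h (translateLTwo (-y n) (ρ n))) U (𝓝 (inner ℂ h ψ))) ∧
      ∀ ψ', IsProfile U ρ ψ' → ‖ψ'‖ ≤ 2 * ‖ψ‖ := by
  obtain ⟨A, hA⟩ := hρ
  obtain ⟨ψ₀, hψ₀⟩ := exists_isProfile U hA 0
  have hbdd : BddAbove (norm '' {ψ | IsProfile U ρ ψ}) := by
    refine ⟨A, ?_⟩
    rintro _ ⟨ψ, ⟨y, hy⟩, rfl⟩
    refine norm_le_of_weak_limit (fun n => ?_) hy
    rw [norm_translateLTwo]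
    exact hA n
  have hle : ∀ ψ', IsProfile U ρ ψ' → ‖ψ'‖ ≤ sSup (norm '' {ψ | IsProfile U ρ ψ}) :=
    fun ψ' h => le_csSup hbdd ⟨ψ', h, rfl⟩
  set σ := sSup (norm '' {ψ | IsProfile U ρ ψ})
  rcases (norm_nonneg ψ₀).trans (hle ψ₀ ⟨0, hψ₀⟩) |>.eq_or_lt with h0 | h0
  · exact ⟨ψ₀, 0, hψ₀, fun ψ' h => (hle ψ' h).trans (by rw [← h0]; positivity)⟩
  · obtain ⟨_, ⟨ψ, ⟨y, hy⟩, rfl⟩, hlt⟩ := exists_lt_of_lt_csSup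
      (s := norm '' {ψ | IsProfile U ρ ψ}) ⟨_, ψ₀, ⟨0, hψ₀⟩, rfl⟩ (half_lt_self h0)
    exact ⟨ψ, y, hy, fun ψ' h => (hle ψ' h).trans (by linarith)⟩

/-- Two sequences of translations that see different weak limits diverge from each other. -/
theorem tendsto_norm_sub_atTop_of_weak_limit_ne {U : Ultrafilter ℕ} {ρ : ℕ → LTwo d}
    (hρ : ∃ A, ∀ n, ‖ρ n‖ ≤ A) {x y : ℕ → EuclideanSpace ℝ (Fin d)} {ψ : LTwo d} (hψ : ψ ≠ 0)
    (hx : ∀ h, Tendsto (fun n => inner ℂ h (translateLTwo (-x n) (ρ n))) U (𝓝 0))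
    (hy : ∀ h, Tendsto (fun n => inner ℂ h (translateLTwo (-y n) (ρ n))) U (𝓝 (inner ℂ h ψ))) :
    Tendsto (fun n => ‖x n - y n‖) U atTop := by
  obtain ⟨A, hA⟩ := hρ
  rw [tendsto_atTop]
  -- Otherwise, U being an ultrafilter, `y n - x n` is U-eventually bounded and converges to some a;
  -- the limit seen from y is then a translate of the one seen from x, hence zero.
  by_contra hcon
  push Not at hcon
  obtain ⟨R, hR⟩ := hcon
  have hR' : ∀ᶠ n in (U : Filter ℕ), ‖y n - x n‖ ≤ R := by
    filter_upwards [hR] with n hn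
    rw [norm_sub_rev]
    exact hn.le
  have hmem : ((U.map fun n => y n - x n : Ultrafilter _) :
      Filter (EuclideanSpace ℝ (Fin d))) ≤ 𝓟 (Metric.closedBall 0 R) := by
    rw [Ultrafilter.coe_map, le_principal_iff, mem_map]
    filter_upwards [hR'] with n hn
    simpa using hn
  obtain ⟨a, -, ha⟩ := (isCompact_closedBall (0 : EuclideanSpace ℝ (Fin d)) R).ultrafilter_le_nhds
    _ hmem
  have ha' : Tendsto (fun n => y n - x n) U (𝓝 a) := ha
  refine hψ (ext_inner_left ℂ fun h => ?_)
  rw [inner_zero_right]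
  refine tendsto_nhds_unique (hy h) ?_
  have h1 : Tendsto (fun n => inner ℂ (translateLTwo (y n - x n) h - translateLTwo a h)
      (translateLTwo (-x n) (ρ n))) U (𝓝 0) := by
    have h2 : Tendsto (fun n => ‖translateLTwo (y n - x n) h - translateLTwo a h‖ * A) U
        (𝓝 (0 * A)) := by
      refine Tendsto.mul_const A ?_
      rw [← tendsto_iff_norm_sub_tendsto_zero]
      exact ((continuous_translateLTwo h).tendsto a).comp ha'
    rw [zero_mul] at h2
    refine squeeze_zero_norm (fun n => (norm_inner_le_norm _ _).trans ?_) h2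
    rw [norm_translateLTwo (-x n)]
    gcongr
    exact hA n
  have h3 := h1.add (hx (translateLTwo a h))
  rw [add_zero] at h3
  refine h3.congr fun n => ?_
  rw [← inner_add_left, sub_add_cancel, ← inner_translateLTwo_neg, translateLTwo_translateLTwo]
  congr 2
  abel

theorem profileRemainder_succ (g ψ : ℕ → LTwo d) (x : ℕ → ℕ → EuclideanSpace ℝ (Fin d))
    (J n : ℕ) : profileRemainder g ψ x (J + 1) n =
      profileRemainder g ψ x J n - translateLTwo (x J n) (ψ J) := by
  rw [profileRemainder, profileRemainder, Finset.sum_range_succ]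
  abel

theorem norm_profileRemainder_le {g : ℕ → LTwo d} {A : ℝ} (hA : ∀ n, ‖g n‖ ≤ A) (ψ : ℕ → LTwo d)
    (x : ℕ → ℕ → EuclideanSpace ℝ (Fin d)) (J n : ℕ) :
    ‖profileRemainder g ψ x J n‖ ≤ A + ∑ j ∈ Finset.range J, ‖ψ j‖ := by
  refine (norm_sub_le _ _).trans (add_le_add (hA n) ((norm_sum_le _ _).trans_eq ?_))
  exact Finset.sum_congr rfl fun j _ => norm_translateLTwo _ _

theorem inner_translateLTwo_neg_profileRemainder_succ (g ψ : ℕ → LTwo d)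
    (x : ℕ → ℕ → EuclideanSpace ℝ (Fin d)) (J n : ℕ) (a : EuclideanSpace ℝ (Fin d)) (h : LTwo d) :
    inner ℂ h (translateLTwo (-a) (profileRemainder g ψ x (J + 1) n)) =
      inner ℂ h (translateLTwo (-a) (profileRemainder g ψ x J n)) -
        inner ℂ h (translateLTwo (x J n - a) (ψ J)) := by
  rw [profileRemainder_succ, translateLTwo_sub, inner_sub_right, translateLTwo_translateLTwo,
    neg_add_eq_sub]

theorem tendsto_inner_profileRemainder_succ_self {l : Filter ℕ} {g ψ : ℕ → LTwo d}
    {x : ℕ → ℕ → EuclideanSpace ℝ (Fin d)} {J : ℕ}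
    (hw : ∀ h, Tendsto (fun n => inner ℂ h (translateLTwo (-x J n) (profileRemainder g ψ x J n)))
      l (𝓝 (inner ℂ h (ψ J)))) (h : LTwo d) :
    Tendsto (fun n => inner ℂ h (translateLTwo (-x J n) (profileRemainder g ψ x (J + 1) n)))
      l (𝓝 0) := by
  simp_rw [inner_translateLTwo_neg_profileRemainder_succ, sub_self, translateLTwo_zero]
  simpa using (hw h).sub_const (inner ℂ h (ψ J))

/-- Asymptotic orthogonality of the cores, from the weak limits, once the vanishing profiles are
known to have diverging cores. -/
theorem tendsto_norm_sub_of_profiles {U : Ultrafilter ℕ} {g ψ : ℕ → LTwo d}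
    {x : ℕ → ℕ → EuclideanSpace ℝ (Fin d)} (hg : ∃ A, ∀ n, ‖g n‖ ≤ A)
    (hw : ∀ J h, Tendsto (fun n => inner ℂ h (translateLTwo (-x J n) (profileRemainder g ψ x J n)))
      U (𝓝 (inner ℂ h (ψ J))))
    (h0 : ∀ i j, i < j → ψ j = 0 → Tendsto (fun n => ‖x i n - x j n‖) U atTop) :
    ∀ j j', j ≠ j' → Tendsto (fun n => ‖x j n - x j' n‖) U atTop := by
  obtain ⟨A, hA⟩ := hg
  -- The induction carries both facts: the J-th remainder is weakly null at all earlier cores, and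
  -- those cores diverge pairwise.
  have key : ∀ J, (∀ j < J, ∀ h, Tendsto (fun n =>
        inner ℂ h (translateLTwo (-x j n) (profileRemainder g ψ x J n))) U (𝓝 0)) ∧
      ∀ j < J, ∀ i < j, Tendsto (fun n => ‖x i n - x j n‖) U atTop := by
    intro J
    induction J with
    | zero => simp
    | succ J ih =>
      have hdiv : ∀ i < J, Tendsto (fun n => ‖x i n - x J n‖) U atTop := by
        intro i hi
        by_cases hJ : ψ J = 0
        · exact h0 i J hi hJ
        · exact tendsto_norm_sub_atTop_of_weak_limit_ne
            ⟨_, norm_profileRemainder_le hA ψ x J⟩ hJ (ih.1 i hi) (hw J)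
      refine ⟨fun j hj h => ?_, fun j hj i hi => ?_⟩
      · rcases Nat.lt_succ_iff_lt_or_eq.1 hj with hj | rfl
        · simp_rw [inner_translateLTwo_neg_profileRemainder_succ]
          -- Seen from the j-th core, the newly subtracted profile escapes to infinity, so its
          -- matrix coefficient vanishes.
          have h1 : Tendsto (fun n => x J n - x j n) U (cocompact _) := by
            refine tendsto_cocompact_of_tendsto_dist_comp_atTop 0 ?_
            simp_rw [dist_zero_right, norm_sub_rev (x J _)]
            exact hdiv j hj
          have h2 := (ih.1 j hj h).sub ((tendsto_inner_translateLTwo_cocompact (ψ J) h).comp h1)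
          rw [sub_zero] at h2
          exact h2
        · exact tendsto_inner_profileRemainder_succ_self (hw j) h
      · rcases Nat.lt_succ_iff_lt_or_eq.1 hj with hj | rfl
        · exact ih.2 j hj i hi
        · exact hdiv i hi
  intro j j' hjj'
  rcases lt_or_gt_of_ne hjj' with h | h
  · exact (key (j' + 1)).2 j' (Nat.lt_succ_self _) j h
  · simp_rw [norm_sub_rev (x j _)]
    exact (key (j + 1)).2 j (Nat.lt_succ_self _) j' h

/-- The profile decomposition in `L²` along an ultrafilter. -/
theorem exists_profiles_ultrafilter (hd : 1 ≤ d) {U : Ultrafilter ℕ}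
    (hU : (U : Filter ℕ) ≤ atTop) {g : ℕ → LTwo d} (hg : ∃ A, ∀ n, ‖g n‖ ≤ A) :
    ∃ (ψ : ℕ → LTwo d) (x : ℕ → ℕ → EuclideanSpace ℝ (Fin d)),
      (∀ J h, Tendsto (fun n =>
        inner ℂ h (translateLTwo (-x J n) (profileRemainder g ψ x J n))) U
          (𝓝 (inner ℂ h (ψ J)))) ∧
      (∀ J ψ', IsProfile U (profileRemainder g ψ x J) ψ' → ‖ψ'‖ ≤ 2 * ‖ψ J‖) ∧
      ∀ j j', j ≠ j' → Tendsto (fun n => ‖x j n - x j' n‖) U atTop := by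
  have hstep : ∀ ρ : {ρ : ℕ → LTwo d // ∃ A, ∀ n, ‖ρ n‖ ≤ A}, ∃ (ψ : LTwo d)
      (y : ℕ → EuclideanSpace ℝ (Fin d)),
      (∀ h, Tendsto (fun n => inner ℂ h (translateLTwo (-y n) (ρ.1 n))) U (𝓝 (inner ℂ h ψ))) ∧
      ∀ ψ', IsProfile U ρ.1 ψ' → ‖ψ'‖ ≤ 2 * ‖ψ‖ :=
    fun ρ => exists_almost_maximal_profile U ρ.2
  choose Ψ Y hY hmax using hstep
  -- The remainders are built together with their boundedness, which the choice of the next profile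
  -- requires.
  let R : ℕ → {ρ : ℕ → LTwo d // ∃ A, ∀ n, ‖ρ n‖ ≤ A} := fun J => Nat.rec ⟨g, hg⟩
    (fun _ ρ => ⟨fun n => ρ.1 n - translateLTwo (Y ρ n) (Ψ ρ), by
      obtain ⟨A, hA⟩ := ρ.2
      refine ⟨A + ‖Ψ ρ‖, fun n => (norm_sub_le _ _).trans ?_⟩
      rw [norm_translateLTwo]
      gcongr
      exact hA n⟩) J
  have hR : ∀ J n, (R (J + 1)).1 n = (R J).1 n - translateLTwo (Y (R J) n) (Ψ (R J)) :=
    fun J n => rfl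
  set ψ : ℕ → LTwo d := fun J => Ψ (R J) with hψ
  set y : ℕ → ℕ → EuclideanSpace ℝ (Fin d) := fun J => Y (R J) with hy
  have hzero : ∀ J, ψ J = 0 → ψ (J + 1) = 0 := by
    intro J hJ
    have h1 : (R (J + 1)).1 = (R J).1 := funext fun n => by
      rw [hR]
      change _ - translateLTwo _ (ψ J) = _
      rw [hJ, translateLTwo_zero_right, sub_zero]
    have h2 := hmax (R J) (ψ (J + 1)) ⟨y (J + 1), fun h => by
      have := hY (R (J + 1)) h
      rwa [h1] at this⟩
    change _ ≤ 2 * ‖ψ J‖ at h2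
    rw [hJ, norm_zero, mul_zero] at h2
    exact norm_le_zero_iff.1 h2
  have hzero' : ∀ i j, i ≤ j → ψ i = 0 → ψ j = 0 := by
    intro i j hij hi
    induction j, hij using Nat.le_induction with
    | base => exact hi
    | succ j _ ih => exact hzero j ih
  -- A direction in which cores can escape; this needs d ≥ 1.
  let e : EuclideanSpace ℝ (Fin d) := EuclideanSpace.single ⟨0, hd⟩ 1
  have he : ‖e‖ = 1 := by simp [e]
  -- Cores of zero profiles are free, and are put at `c j n • e`. The sum dominates the norms of all
  -- earlier `y k n`; the factor j + 1 separates two such cores by at least n.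
  let c : ℕ → ℕ → ℝ := fun j n => (j + 1) * n + ∑ k ∈ Finset.range j, ‖y k n‖
  classical
  let x : ℕ → ℕ → EuclideanSpace ℝ (Fin d) := fun j n => if ψ j = 0 then c j n • e else y j n
  have hRx : ∀ J n, (R J).1 n = profileRemainder g ψ x J n := by
    intro J n
    induction J with
    | zero => simp [profileRemainder, R]
    | succ J ih =>
      rw [hR, profileRemainder_succ, ih]
      congr 1
      change translateLTwo (y J n) (ψ J) = _
      by_cases hJ : ψ J = 0
      · rw [hJ, translateLTwo_zero_right, translateLTwo_zero_right]
      · simp only [x, if_neg hJ]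
  have hRx' : ∀ J, (R J).1 = profileRemainder g ψ x J := fun J => funext (hRx J)
  have hmax' : ∀ J ψ', IsProfile U (profileRemainder g ψ x J) ψ' → ‖ψ'‖ ≤ 2 * ‖ψ J‖ := by
    intro J ψ' h
    rw [← hRx'] at h
    exact hmax (R J) ψ' h
  have hw : ∀ J h, Tendsto (fun n =>
      inner ℂ h (translateLTwo (-x J n) (profileRemainder g ψ x J n))) U
        (𝓝 (inner ℂ h (ψ J))) := by
    intro J
    by_cases hJ : ψ J = 0
    -- If ψ_J = 0, almost maximality makes every profile of the remainder zero, so the relocated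
    -- core also sees weak limit zero.
    · obtain ⟨A, hA⟩ := (R J).2
      obtain ⟨ψ', hψ'⟩ := exists_isProfile U hA (x J)
      rw [hRx'] at hψ'
      have h2 := hmax' J ψ' ⟨x J, hψ'⟩
      rw [hJ, norm_zero, mul_zero] at h2
      rw [hJ, ← norm_le_zero_iff.1 h2]
      exact hψ'
    · intro h
      have h1 := hY (R J) h
      simp only [x, if_neg hJ, ← hRx]
      exact h1
  refine ⟨ψ, x, hw, hmax', tendsto_norm_sub_of_profiles hg hw fun i j hij hj => ?_⟩
  have hn : Tendsto (fun n : ℕ => (n : ℝ)) U atTop := tendsto_natCast_atTop_atTop.mono_left hU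
  refine tendsto_atTop_mono (fun n => ?_) hn
  have hsum : ∑ k ∈ Finset.range i, ‖y k n‖ + ‖y i n‖ ≤ ∑ k ∈ Finset.range j, ‖y k n‖ := by
    rw [← Finset.sum_range_succ]
    exact Finset.sum_le_sum_of_subset_of_nonneg
      (Finset.range_subset_range.2 hij) fun _ _ _ => norm_nonneg _
  have hsum0 : 0 ≤ ∑ k ∈ Finset.range i, ‖y k n‖ := Finset.sum_nonneg fun _ _ => norm_nonneg _
  have hij' : (i : ℝ) + 1 ≤ j := by exact_mod_cast hij
  have hn0 : (0 : ℝ) ≤ n := Nat.cast_nonneg n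
  have hi0 : (0 : ℝ) ≤ i := Nat.cast_nonneg i
  have hc : (n : ℝ) + ‖y i n‖ ≤ c j n := by
    simp only [c]
    nlinarith
  rw [norm_sub_rev]
  by_cases hi : ψ i = 0
  · simp only [x, if_pos hi, if_pos hj]
    rw [← sub_smul, norm_smul, he, mul_one]
    refine le_trans ?_ (le_abs_self _)
    simp only [c]
    have := norm_nonneg (y i n)
    nlinarith
  · simp only [x, if_neg hi, if_pos hj]
    refine le_trans ?_ (norm_sub_norm_le _ _)
    rw [norm_smul, he, mul_one]
    have := le_abs_self (c j n)
    rw [Real.norm_eq_abs]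
    linarith

end Profiles

/-! ### From the ultrafilter to a subsequence -/

section Subsequence

variable {d : ℕ}

theorem tendsto_norm_sq_sub_of_weak_limit {H ι : Type*} [NormedAddCommGroup H]
    [InnerProductSpace ℂ H] {l : Filter ι} {f : ι → H} {ψ : H}
    (h : Tendsto (fun n => inner ℂ ψ (f n)) l (𝓝 (inner ℂ ψ ψ))) :
    Tendsto (fun n => ‖f n‖ ^ 2 - ‖ψ‖ ^ 2 - ‖f n - ψ‖ ^ 2) l (𝓝 0) := by
  have h1 := (((Complex.continuous_re.tendsto _).comp h).const_mul 2).sub_const (2 * ‖ψ‖ ^ 2)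
  have h2 : (inner ℂ ψ ψ : ℂ).re = ‖ψ‖ ^ 2 := inner_self_eq_norm_sq (𝕜 := ℂ) ψ
  rw [h2, sub_self] at h1
  refine h1.congr fun n => ?_
  have h3 := @norm_sub_sq ℂ _ _ _ _ (f n) ψ
  rw [inner_re_symm] at h3
  rw [h3]
  simp only [Function.comp_apply, RCLike.re_to_complex]
  ring

theorem bddAbove_norm_inner_translateLTwo (k f : LTwo d) :
    BddAbove (Set.range fun a : EuclideanSpace ℝ (Fin d) => ‖inner ℂ k (translateLTwo a f)‖) := by
  refine ⟨‖k‖ * ‖f‖, ?_⟩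
  rintro _ ⟨a, rfl⟩
  exact (norm_inner_le_norm _ _).trans_eq (by rw [norm_translateLTwo])

/-- If all the profiles of a bounded sequence are small, then so are its correlations with the
translates of a fixed function. -/
theorem exists_tendsto_iSup_norm_inner {U : Ultrafilter ℕ} (hU : (U : Filter ℕ) ≤ atTop)
    {ρ : ℕ → LTwo d} (hρ : ∃ A, ∀ n, ‖ρ n‖ ≤ A) {D : ℝ}
    (hD : ∀ ψ, IsProfile U ρ ψ → ‖ψ‖ ≤ D) (k : LTwo d) :
    ∃ σ ≤ ‖k‖ * D, Tendsto (fun n => ⨆ a, ‖inner ℂ k (translateLTwo a (ρ n))‖) U (𝓝 σ) := by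
  obtain ⟨A, hA⟩ := hρ
  set S : ℕ → ℝ := fun n => ⨆ a, ‖inner ℂ k (translateLTwo a (ρ n))‖
  have hS : ∀ n, |S n| ≤ ‖k‖ * A := by
    intro n
    rw [abs_of_nonneg (Real.iSup_nonneg fun _ => norm_nonneg _)]
    refine ciSup_le fun a => (norm_inner_le_norm _ _).trans ?_
    rw [norm_translateLTwo]
    gcongr
    exact hA n
  obtain ⟨σ, hσ⟩ := exists_tendsto_of_bounded U hS
  -- Nearly optimal translates: recentred there, the sequence has a weak limit, a profile, whose
  -- pairing with k dominates the limit of the suprema.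
  have hy : ∀ n : ℕ, ∃ a, S n - 1 / ((n : ℝ) + 1) < ‖inner ℂ k (translateLTwo a (ρ n))‖ :=
    fun n => exists_lt_of_lt_ciSup (sub_lt_self _ (by positivity))
  choose y hy using hy
  obtain ⟨ψ, hψ⟩ := exists_isProfile U hA fun n => -y n
  refine ⟨σ, ?_, hσ⟩
  have h1 : Tendsto (fun n : ℕ => S n - 1 / ((n : ℝ) + 1)) U (𝓝 (σ - 0)) :=
    hσ.sub (tendsto_one_div_add_atTop_nhds_zero_nat.mono_left hU)
  have h2 := le_of_tendsto_of_tendsto h1 (hψ k).norm (Eventually.of_forall fun n => by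
    simp only [neg_neg]
    exact (hy n).le)
  rw [sub_zero] at h2
  refine (h2.trans (norm_inner_le_norm _ _)).trans ?_
  gcongr
  exact hD ψ ⟨_, hψ⟩

/-- The profile decomposition of a bounded sequence in `L²`, with respect to translations. The
remainders vanish in the sense of correlations with translates of fixed functions. -/
theorem exists_profiles_subsequence (hd : 1 ≤ d) {g : ℕ → LTwo d} (hg : ∃ A, ∀ n, ‖g n‖ ≤ A)
    (k : ℕ → LTwo d) :
    ∃ (φ : ℕ → ℕ) (ψ : ℕ → LTwo d) (x : ℕ → ℕ → EuclideanSpace ℝ (Fin d)),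
      StrictMono φ ∧
      (∀ J h, Tendsto (fun n =>
        inner ℂ h (translateLTwo (-x J n) (profileRemainder (g ∘ φ) ψ x J n))) atTop
          (𝓝 (inner ℂ h (ψ J)))) ∧
      (∀ j j', j ≠ j' → Tendsto (fun n => ‖x j n - x j' n‖) atTop atTop) ∧
      ∀ J K, ∀ ε > 0, ∀ᶠ n in atTop, ∀ a,
        ‖inner ℂ (k K) (translateLTwo a (profileRemainder (g ∘ φ) ψ x J n))‖ ≤
          2 * ‖k K‖ * ‖ψ J‖ + ε := by
  let U : Ultrafilter ℕ := Ultrafilter.of atTop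
  have hU : (U : Filter ℕ) ≤ atTop := Ultrafilter.of_le atTop
  obtain ⟨ψ, x, hw, hmax, hdiv⟩ := exists_profiles_ultrafilter hd hU hg
  obtain ⟨A, hA⟩ := hg
  have : Fact ((2 : ℝ≥0∞) ≠ ∞) := ⟨by simp⟩
  have hdense : DenseRange (TopologicalSpace.denseSeq (LTwo d)) :=
    TopologicalSpace.denseRange_denseSeq _
  set e := TopologicalSpace.denseSeq (LTwo d)
  have hcorr : ∀ J K, ∃ σ ≤ ‖k K‖ * (2 * ‖ψ J‖), Tendsto (fun n =>
      ⨆ a, ‖inner ℂ (k K) (translateLTwo a (profileRemainder g ψ x J n))‖) U (𝓝 σ) := fun J K =>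
    exists_tendsto_iSup_norm_inner hU ⟨_, norm_profileRemainder_le hA ψ x J⟩ (hmax J) (k K)
  choose σ hσ hσlim using hcorr
  -- Weak convergence on a dense sequence, divergence of cores and convergence of the maximal
  -- correlations are each countably many conditions, encoded as filters containing U.
  let F₁ : Filter ℕ := ⨅ J, ⨅ i, comap (fun n =>
    inner ℂ (e i) (translateLTwo (-x J n) (profileRemainder g ψ x J n))) (𝓝 (inner ℂ (e i) (ψ J)))
  let F₂ : Filter ℕ := ⨅ p : {p : ℕ × ℕ // p.1 ≠ p.2},
    comap (fun n => ‖x p.1.1 n - x p.1.2 n‖) atTop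
  let F₃ : Filter ℕ := ⨅ J, ⨅ K, comap (fun n =>
    ⨆ a, ‖inner ℂ (k K) (translateLTwo a (profileRemainder g ψ x J n))‖) (𝓝 (σ J K))
  obtain ⟨φ, hφ, hlim⟩ := exists_strictMono_tendsto U hU (F := F₁ ⊓ F₂ ⊓ F₃) (by
    refine le_inf (le_inf ?_ ?_) ?_
    · exact le_iInf fun J => le_iInf fun i => (hw J (e i)).le_comap
    · exact le_iInf fun p => (hdiv p.1.1 p.1.2 p.2).le_comap
    · exact le_iInf fun J => le_iInf fun K => (hσlim J K).le_comap)
  rw [tendsto_inf, tendsto_inf] at hlim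
  obtain ⟨⟨h1, h2⟩, h3⟩ := hlim
  simp only [F₁, F₂, F₃, tendsto_iInf, tendsto_comap_iff] at h1 h2 h3
  refine ⟨φ, ψ, fun j n => x j (φ n), hφ, fun J h => ?_, fun j j' hjj' => h2 ⟨(j, j'), hjj'⟩,
    fun J K ε hε => ?_⟩
  · have h4 := tendsto_inner_zero_of_dense (f := fun n => translateLTwo (-x J (φ n))
      (profileRemainder g ψ x J (φ n)) - ψ J) (A := A + ∑ j ∈ Finset.range J, ‖ψ j‖ + ‖ψ J‖)
      (fun n => (norm_sub_le _ _).trans (by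
        rw [norm_translateLTwo]
        gcongr
        exact norm_profileRemainder_le hA ψ x J _)) hdense (fun i => by
        simpa [inner_sub_right] using (h1 J i).sub_const (inner ℂ (e i) (ψ J))) h
    have h5 := h4.add_const (inner ℂ h (ψ J))
    simp only [inner_sub_right, sub_add_cancel, zero_add] at h5
    exact h5
  · have h4 : σ J K < 2 * ‖k K‖ * ‖ψ J‖ + ε := by linarith [hσ J K]
    filter_upwards [(h3 J K).eventually_lt_const h4] with n hn a
    exact (le_ciSup (bddAbove_norm_inner_translateLTwo _ _) a).trans hn.le

end Subsequence

/-! ### Transfer to Hˢ and L^q -/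

section Sobolev

variable {d : ℕ} {s : ℝ}

theorem besselPotential_profileRemainder (hs : 0 ≤ s) (g ψ : ℕ → LTwo d)
    (x : ℕ → ℕ → EuclideanSpace ℝ (Fin d)) (J n : ℕ) :
    profileRemainder (fun n => besselPotential hs (g n)) (fun j => besselPotential hs (ψ j)) x J n =
      besselPotential hs (profileRemainder g ψ x J n) := by
  induction J with
  | zero => simp [profileRemainder]
  | succ J ih =>
    rw [profileRemainder_succ, profileRemainder_succ, ih, besselPotential, fourierMul_sub,
      fourierMul_translateLTwo]

theorem lqNorm_translateLTwo (q : ℝ) (a : EuclideanSpace ℝ (Fin d)) (f : LTwo d) :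
    lqNorm q (translateLTwo a f) = lqNorm q f := by
  rw [lqNorm, lqNorm, eLpNorm_translateLTwo]

variable {g ψ : ℕ → LTwo d} {x : ℕ → ℕ → EuclideanSpace ℝ (Fin d)}

/-- Recentring at the J-th core preserves norms and makes ψ_J a genuine weak limit, so the cross
term in the expanded square disappears. Divergence of the cores plays no role. -/
theorem tendsto_norm_sq_sub_sum_profiles
    (hw : ∀ J h, Tendsto (fun n => inner ℂ h (translateLTwo (-x J n) (profileRemainder g ψ x J n)))
      atTop (𝓝 (inner ℂ h (ψ J)))) (J : ℕ) :
    Tendsto (fun n => ‖g n‖ ^ 2 -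
      (∑ j ∈ Finset.range J, ‖ψ j‖ ^ 2 + ‖profileRemainder g ψ x J n‖ ^ 2)) atTop (𝓝 0) := by
  have h := tendsto_telescope (F := fun J n => ‖profileRemainder g ψ x J n‖ ^ 2)
    (c := fun j => ‖ψ j‖ ^ 2) (l := atTop) (fun J => ?_) J
  · simpa [profileRemainder] using h
  · refine (tendsto_norm_sq_sub_of_weak_limit (hw J (ψ J))).congr fun n => ?_
    have h1 : translateLTwo (-x J n) (profileRemainder g ψ x J n) - ψ J =
        translateLTwo (-x J n) (profileRemainder g ψ x (J + 1) n) := by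
      rw [profileRemainder_succ, translateLTwo_sub, translateLTwo_neg_translateLTwo]
    rw [h1, norm_translateLTwo, norm_translateLTwo]

theorem tendsto_lqNorm_rpow_sub_sum_profiles (hs0 : 0 < s) (hs : s < (d : ℝ) / 2) {q : ℝ}
    (hq : 2 < q) (hq' : q < 2 * d / (d - 2 * s)) (hg : ∃ A, ∀ n, ‖g n‖ ≤ A)
    (hw : ∀ J h, Tendsto (fun n => inner ℂ h (translateLTwo (-x J n) (profileRemainder g ψ x J n)))
      atTop (𝓝 (inner ℂ h (ψ J)))) (J : ℕ) :
    Tendsto (fun n => lqNorm q (besselPotential hs0.le (g n)) ^ q -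
      (∑ j ∈ Finset.range J, lqNorm q (besselPotential hs0.le (ψ j)) ^ q +
        lqNorm q (besselPotential hs0.le (profileRemainder g ψ x J n)) ^ q)) atTop (𝓝 0) := by
  obtain ⟨A, hA⟩ := hg
  have h := tendsto_telescope
    (F := fun J n => lqNorm q (besselPotential hs0.le (profileRemainder g ψ x J n)) ^ q)
    (c := fun j => lqNorm q (besselPotential hs0.le (ψ j)) ^ q) (l := atTop) (fun J => ?_) J
  · simpa [profileRemainder] using h
  · refine (tendsto_lqNorm_rpow_besselPotential_add_sub hs0 hs hq hq' (ψ J)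
      (e := fun n => translateLTwo (-x J n) (profileRemainder g ψ x (J + 1) n))
      (fun n => (norm_translateLTwo _ _).trans_le (norm_profileRemainder_le hA ψ x (J + 1) n))
      (tendsto_inner_profileRemainder_succ_self (hw J))).congr fun n => ?_
    have h1 : besselPotential hs0.le (ψ J) +
        besselPotential hs0.le (translateLTwo (-x J n) (profileRemainder g ψ x (J + 1) n)) =
        translateLTwo (-x J n) (besselPotential hs0.le (profileRemainder g ψ x J n)) := by
      rw [profileRemainder_succ, translateLTwo_sub, translateLTwo_neg_translateLTwo,
        besselPotential, fourierMul_sub, fourierMul_translateLTwo, add_sub_cancel]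
    rw [h1, lqNorm_translateLTwo, besselPotential, fourierMul_translateLTwo, lqNorm_translateLTwo]

/-- The decoupling bounds every partial sum of ‖ψ_j‖² by A². -/
theorem tendsto_norm_profile_zero (hg : ∃ A, ∀ n, ‖g n‖ ≤ A)
    (hw : ∀ J h, Tendsto (fun n => inner ℂ h (translateLTwo (-x J n) (profileRemainder g ψ x J n)))
      atTop (𝓝 (inner ℂ h (ψ J)))) : Tendsto (fun J => ‖ψ J‖) atTop (𝓝 0) := by
  obtain ⟨A, hA⟩ := hg
  have hsum : ∀ J, ∑ j ∈ Finset.range J, ‖ψ j‖ ^ 2 ≤ A ^ 2 := by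
    intro J
    have h1 := (tendsto_norm_sq_sub_sum_profiles hw J).const_sub (A ^ 2)
    rw [sub_zero] at h1
    refine ge_of_tendsto h1 (Eventually.of_forall fun n => ?_)
    have h2 : ‖g n‖ ^ 2 ≤ A ^ 2 := by gcongr; exact hA n
    have h3 := sq_nonneg ‖profileRemainder g ψ x J n‖
    linarith
  have h := (summable_of_sum_range_le (fun j => sq_nonneg ‖ψ j‖) hsum).tendsto_atTop_zero
  simpa using h.sqrt

/-- High frequencies are small uniformly in J and, for each J, in all large n. Low frequencies are
pointwise correlations, of sup norm controlled by ‖ψ_J‖, and interpolate with the L² bound. -/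
theorem tendsto_limsup_eLpNorm_profileRemainder (hs0 : 0 < s) (hs : s < (d : ℝ) / 2) {q : ℝ}
    (hq : 2 < q) (hq' : q < 2 * d / (d - 2 * s)) (hg : ∃ A, ∀ n, ‖g n‖ ≤ A)
    (hw : ∀ J h, Tendsto (fun n => inner ℂ h (translateLTwo (-x J n) (profileRemainder g ψ x J n)))
      atTop (𝓝 (inner ℂ h (ψ J))))
    (hcorr : ∀ J K, ∀ ε > 0, ∀ᶠ n in atTop, ∀ a,
      ‖inner ℂ (lowBesselKernel d hs0.le K) (translateLTwo a (profileRemainder g ψ x J n))‖ ≤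
        2 * ‖lowBesselKernel d hs0.le K‖ * ‖ψ J‖ + ε) :
    Tendsto (fun J => limsup (fun n => eLpNorm
      (besselPotential hs0.le (profileRemainder g ψ x J n)) (ENNReal.ofReal q) volume) atTop)
      atTop (𝓝 0) := by
  obtain ⟨τ, hτ0, hτlim, hτ⟩ := exists_eLpNorm_besselPotential_sub_low_le hs0 hs hq hq'
  have hψ := tendsto_norm_profile_zero hg hw
  obtain ⟨A, hA⟩ := hg
  have hA0 : 0 ≤ A := (norm_nonneg _).trans (hA 0)
  have hθ : 0 < 1 - 2 / q := sub_pos.2 ((div_lt_one (by linarith)).2 hq)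
  rw [ENNReal.tendsto_nhds_zero]
  intro ε hε
  obtain ⟨δ, hδ0, hδε⟩ := ENNReal.lt_iff_exists_nnreal_btwn.1 hε
  have hδ0' : (0 : ℝ) < δ := by exact_mod_cast hδ0
  -- The cutoff is fixed before J, using the bound A + 1 on remainders that holds for large n.
  obtain ⟨K, hK⟩ := ((hτlim.mul_const (A + 1)).eventually_lt_const (u := (δ : ℝ) / 2)
    (by rw [zero_mul]; positivity)).exists
  set κ := ‖lowBesselKernel d hs0.le K‖
  -- The slack ε in `hcorr` is taken as 1/(J + 1), so that it vanishes with J.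
  have hb : Tendsto (fun J : ℕ => (A + 1) ^ (2 / q) *
      (2 * κ * ‖ψ J‖ + 1 / ((J : ℝ) + 1)) ^ (1 - 2 / q)) atTop (𝓝 0) := by
    have h1 := (((hψ.const_mul (2 * κ)).add tendsto_one_div_add_atTop_nhds_zero_nat).rpow_const
      (p := 1 - 2 / q) (Or.inr hθ.le)).const_mul ((A + 1) ^ (2 / q))
    simpa [Real.zero_rpow hθ.ne'] using h1
  filter_upwards [hb.eventually_lt_const (u := (δ : ℝ) / 2) (by positivity)] with J hJ
  refine le_trans (limsup_le_of_le (by isBoundedDefault) ?_) hδε.le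
  -- An error of at most 1 in the decoupling gives ‖ρ‖² ≤ A² + 1 ≤ (A + 1)², uniformly in J.
  have hbound := (tendsto_norm_sq_sub_sum_profiles hw J).eventually_const_lt
    (u := -1) (by norm_num)
  filter_upwards [hcorr J K (1 / ((J : ℝ) + 1)) (by positivity), hbound] with n hn hn'
  have hρ : ‖profileRemainder g ψ x J n‖ ≤ A + 1 := by
    have h1 : 0 ≤ ∑ j ∈ Finset.range J, ‖ψ j‖ ^ 2 := Finset.sum_nonneg fun _ _ => sq_nonneg _
    have h2 : ‖g n‖ ^ 2 ≤ A ^ 2 := by gcongr; exact hA n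
    refine abs_le_of_sq_le_sq' ?_ (by linarith) |>.2
    nlinarith
  set ρ := profileRemainder g ψ x J n
  have heq : besselPotential hs0.le ρ =
      (besselPotential hs0.le ρ - lowBesselPotential hs0.le K ρ) + lowBesselPotential hs0.le K ρ := by
    abel
  rw [heq, eLpNorm_congr_ae (Lp.coeFn_add _ _)]
  refine (eLpNorm_add_le (Lp.aestronglyMeasurable _) (Lp.aestronglyMeasurable _)
    (ENNReal.one_le_ofReal.2 (by linarith))).trans ?_
  have hlow : ∀ᵐ y, ‖lowBesselPotential hs0.le K ρ y‖ ≤ 2 * κ * ‖ψ J‖ + 1 / ((J : ℝ) + 1) := by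
    filter_upwards [coeFn_lowBesselPotential hs0.le K ρ] with y hy
    rw [hy]
    exact hn y
  have h1 := (hτ K ρ).trans (ENNReal.ofReal_le_ofReal (q := (δ : ℝ) / 2)
    (le_trans (by have := hτ0 K; gcongr) hK.le))
  have h2 := (LTwo.eLpNorm_le_of_bound hq ((norm_lowBesselPotential_le hs0.le K ρ).trans hρ)
    (by positivity) hlow).trans (ENNReal.ofReal_le_ofReal hJ.le)
  refine (add_le_add h1 h2).trans_eq ?_
  rw [← ENNReal.ofReal_add (by positivity) (by positivity), add_halves, ENNReal.ofReal_coe_nnreal]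

end Sobolev

end

/-! ### The profile decomposition in Hˢ -/

theorem mainTheorem9 (d : ℕ) (hd : 1 ≤ d) (s : ℝ) (hs0 : 0 < s) (hs : s < (d : ℝ) / 2)
    (u : ℕ → LTwo d) (hu : ∀ n, MemHs s (u n)) (hbdd : ∃ C : ℝ, ∀ n, hsNorm s (u n) ≤ C) :
    ∃ (φ : ℕ → ℕ) (v : ℕ → LTwo d) (x : ℕ → ℕ → EuclideanSpace ℝ (Fin d)),
      StrictMono φ ∧
      (∀ j, MemHs s (v j)) ∧
      (∀ J : ℕ, Tendsto
        (fun n => hsNorm s (u (φ n)) ^ 2 -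
          ((∑ j ∈ Finset.range J, hsNorm s (v j) ^ 2) +
            hsNorm s (profileRemainder (u ∘ φ) v x J n) ^ 2))
        atTop (𝓝 0)) ∧
      (∀ q : ℝ, 2 < q → q < 2 * d / (d - 2 * s) →
        (∀ n, MemLp (u (φ n)) (ENNReal.ofReal q) volume) ∧
        (∀ j, MemLp (v j) (ENNReal.ofReal q) volume) ∧
        ∀ J : ℕ, Tendsto
          (fun n => lqNorm q (u (φ n)) ^ q -
            ((∑ j ∈ Finset.range J, lqNorm q (v j) ^ q) +
              lqNorm q (profileRemainder (u ∘ φ) v x J n) ^ q))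
          atTop (𝓝 0)) ∧
      (∀ j j' : ℕ, j ≠ j' → Tendsto (fun n => ‖x j n - x j' n‖) atTop atTop) ∧
      (∀ q : ℝ, 2 < q → q < 2 * d / (d - 2 * s) →
        Tendsto
          (fun J => limsup
            (fun n => eLpNorm (profileRemainder (u ∘ φ) v x J n) (ENNReal.ofReal q) volume) atTop)
          atTop (𝓝 0)) := by
  choose g hg using fun n => exists_besselPotential_eq hs0.le (hu n)
  obtain rfl : u = fun n => besselPotential hs0.le (g n) := funext fun n => (hg n).symm
  simp only [hsNorm_besselPotential] at hbdd
  -- Testing correlations against the low-frequency kernels of all cutoffs makes one subsequence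
  -- serve every q.
  obtain ⟨φ, ψ, x, hφ, hw, hdiv, hcorr⟩ :=
    exists_profiles_subsequence hd hbdd fun K => lowBesselKernel d hs0.le K
  have hbdd' : ∃ A, ∀ n, ‖(g ∘ φ) n‖ ≤ A := hbdd.imp fun A hA n => hA (φ n)
  have hrem : ∀ J n, profileRemainder ((fun n => besselPotential hs0.le (g n)) ∘ φ)
      (fun j => besselPotential hs0.le (ψ j)) x J n =
      besselPotential hs0.le (profileRemainder (g ∘ φ) ψ x J n) :=
    fun J n => besselPotential_profileRemainder hs0.le (g ∘ φ) ψ x J n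
  refine ⟨φ, fun j => besselPotential hs0.le (ψ j), x, hφ,
    fun j => memHs_besselPotential hs0.le (ψ j), fun J => ?_, fun q hq hq' =>
    ⟨fun n => memLp_besselPotential hs0 hs hq hq' _, fun j => memLp_besselPotential hs0 hs hq hq' _,
      fun J => ?_⟩, hdiv, fun q hq hq' => ?_⟩
  · simp only [hrem, hsNorm_besselPotential]
    exact tendsto_norm_sq_sub_sum_profiles hw J
  · simp only [hrem]
    exact tendsto_lqNorm_rpow_sub_sum_profiles hs0 hs hq hq' hbdd' hw J
  · simp only [hrem]
    exact tendsto_limsup_eLpNorm_profileRemainder hs0 hs hq hq' hbdd' hw hcorr
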